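/- Let $N\subset\mathbb R^p$ be a closed (compact, without boundary) smooth embedded submanifold with the induced Riemannian metric, and let $S^1=\mathbb R/2\pi\mathbb Z$. For $T>0$, a harmonic map $u:[0,T]\times S^1\to N$ is a map, smooth up to the boundary as a map into $\mathbb R^p$, with values in $N$ and such that $\Delta u=\partial_t^2u+\partial_\theta^2u$ is everywhere normal to $N$ at $u$. Write $|\nabla u|^2=|\partial_tu|^2+|\partial_\theta u|^2$ and $|\nabla^2u|^2=|\partial_t^2u|^2+2|\partial_t\partial_\theta u|^2+|\partial_\theta^2u|^2$. There are functions $C_3(L)$ and $C(L)$ of $L$ alone such that for every such $N$ there is $\varepsilon_1=\varepsilon_1(N)>0$ for which the following three statements hold. Consider the following assumptions on constants $C_2\in\mathbb R$, $T\ge 1$ and a harmonic map $u:[0,T]\times S^1\to N$: (i) $|\nabla u|+|\nabla^2u|\le\varepsilon_1^{1/2}$ on $[0,T]\times S^1$; (ii) $\int_{\{t\}\times S^1}\left(|\partial_\theta u|^2-|\partial_tu|^2\right)d\theta=0$ for all $t\in[0,T]$; (iii) with $a=\left(\int_{\{0\}\times S^1}|\nabla u|^2d\theta\right)^{1/2}$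 and $b=\left(\int_{\{T\}\times S^1}|\nabla u|^2d\theta\right)^{1/2}$, $$\sup_{[0,1]\times S^1}|\partial_\theta^2u|\le C_2a<\varepsilon_1^{1/2},\qquad \sup_{[T-1,T]\times S^1}|\partial_\theta^2u|\le C_2b\le\varepsilon_1^{1/2}.$$ (1) Under (i)-(iii), for every $t\in[0,T]$, $$\left(\int_{\{t\}\times S^1}|\nabla u|^2d\theta\right)^{1/2}\le 2E_1e^{-t}+2E_2e^{t},\qquad E_1=\frac{ae^{2T}-be^{T}}{e^{2T}-1},\quad E_2=\frac{be^{T}-a}{e^{2T}-1},$$ and the right-hand side is the unique solution on $[0,T]$ of $g''=g$ with $g(0)=2a$, $g(T)=2b$. (2) Assume (i)-(iii), $L\ge2$ and $T>4L$. If $\int_{\{L'\}\times S^1}|\nabla u|^2d\theta\ge\int_{\{0\}\times S^1}|\nabla u|^2d\theta$ for some $L'\in[L,3L]$, then $$\int_{\{0\}\times S^1}|\nabla u|^2d\theta\le C_3(L)\,e^{-2T}\int_{\{T\}\times S^1}|\nabla u|^2d\theta.$$ (3) Let $L>2$, let $m\ge1$ be an integer, $\tilde L=mL$, and $W_i=[(i-1)L,iL]\times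 S^1$ for $i=1,\dots,m$. Let $u:[0,\tilde L]\times S^1\to N$ be a harmonic map with $\int_{W_i}|\nabla u|^2<\varepsilon_1$ for $i=1,\dots,m$, with $\int_{\{t\}\times S^1}\left(|\partial_tu|^2-|\partial_\theta u|^2\right)d\theta=0$ for all $t\in[0,\tilde L]$, and with $\int_{W_i}|\nabla u|^2\le\frac12\int_{W_{i+1}}|\nabla u|^2$ for $i=1,\dots,m-1$. Then $$\int_{W_1}|\nabla u|^2\le C(L)\,e^{-2\tilde L}\int_{W_m}|\nabla u|^2.$$ -/

import Mathlib

open Set Filter Topology MeasureTheory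
open scoped ContDiff

noncomputable section

namespace CylHarmonic

/-- The Euclidean space `ℝ^p` in which the target manifold lies. -/
abbrev E (p : ℕ) : Type := EuclideanSpace ℝ (Fin p)

/-- `N ⊆ ℝ^p` is a closed (compact, without boundary) smooth embedded submanifold of dimension `n`:
near each of its points it is a regular level set of a smooth map into `ℝ^(p-n)`.
It carries the Riemannian metric induced from `ℝ^p`. -/
def IsClosedSubmanifold {p : ℕ} (n : ℕ) (N : Set (E p)) : Prop :=
  IsCompact N ∧ ∃ k : ℕ, n + k = p ∧
    ∀ x ∈ N, ∃ (U : Set (E p)) (F : E p → E k), IsOpen U ∧ x ∈ U ∧ ContDiffOn ℝ ∞ F U ∧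
      N ∩ U = {y ∈ U | F y = 0} ∧ ∀ y ∈ N ∩ U, Function.Surjective (fderiv ℝ F y)

/-- The tangent space `T_x N`: the velocities at `x` of curves in `N` through `x`. -/
def tangentVectors {p : ℕ} (N : Set (E p)) (x : E p) : Set (E p) :=
  {v | ∃ γ : ℝ → E p, γ 0 = x ∧ (∀ᶠ s in 𝓝 (0 : ℝ), γ s ∈ N) ∧ HasDerivAt γ v 0}

/-!
Maps on the cylinder `[0,T] × S¹`, `S¹ = ℝ/2πℤ`, are written `u t θ` with `u t` being
`2π`-periodic. Values for `t` outside `[0,T]` play no role: the `t`-derivatives are taken within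
`[0,T]` (so they are one-sided at `t = 0` and `t = T`).
-/

/-- `∂_t u`. -/
def dt {p : ℕ} (T : ℝ) (u : ℝ → ℝ → E p) (t θ : ℝ) : E p :=
  derivWithin (fun s => u s θ) (Icc 0 T) t

/-- `∂_θ u`. -/
def dθ {p : ℕ} (u : ℝ → ℝ → E p) (t θ : ℝ) : E p := deriv (u t) θ

/-- `u` is a (smooth up to the boundary) harmonic map from the flat cylinder `[0,T] × S¹` to `N`:
its tension field vanishes, i.e. `Δu = ∂_t²u + ∂_θ²u` is normal to `N` at `u`. -/
structure IsHarmonicMap {p : ℕ} (N : Set (E p)) (T : ℝ) (u : ℝ → ℝ → E p) : Prop where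
  smooth : ContDiffOn ℝ ∞ (fun z : ℝ × ℝ => u z.1 z.2) (Icc 0 T ×ˢ univ)
  periodic : ∀ t ∈ Icc 0 T, Function.Periodic (u t) (2 * Real.pi)
  mem : ∀ t ∈ Icc 0 T, ∀ θ, u t θ ∈ N
  tension : ∀ t ∈ Icc 0 T, ∀ θ, ∀ v ∈ tangentVectors N (u t θ),
    inner ℝ (dt T (dt T u) t θ + dθ (dθ u) t θ) v = 0

/-- `|∇u|²`. -/
def gradSq {p : ℕ} (T : ℝ) (u : ℝ → ℝ → E p) (t θ : ℝ) : ℝ :=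
  ‖dt T u t θ‖ ^ 2 + ‖dθ u t θ‖ ^ 2

/-- `|∇²u|²`. -/
def hessSq {p : ℕ} (T : ℝ) (u : ℝ → ℝ → E p) (t θ : ℝ) : ℝ :=
  ‖dt T (dt T u) t θ‖ ^ 2 + 2 * ‖dt T (dθ u) t θ‖ ^ 2 + ‖dθ (dθ u) t θ‖ ^ 2

/-- `∫_{ {t} × S¹ } |∇u|²`. -/
def sliceEnergy {p : ℕ} (T : ℝ) (u : ℝ → ℝ → E p) (t : ℝ) : ℝ :=
  ∫ θ in (0 : ℝ)..(2 * Real.pi), gradSq T u t θ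

/-- `∫_{ [s₁,s₂] × S¹ } |∇u|²`. -/
def cylEnergy {p : ℕ} (T : ℝ) (u : ℝ → ℝ → E p) (s₁ s₂ : ℝ) : ℝ :=
  ∫ t in s₁..s₂, sliceEnergy T u t

/-- `∫_{ {t} × S¹ } |∂_θ u|² - |∂_t u|² = 0` for every `t ∈ [0,T]`. -/
def PohozaevZero {p : ℕ} (T : ℝ) (u : ℝ → ℝ → E p) : Prop :=
  ∀ t ∈ Icc 0 T,
    ∫ θ in (0 : ℝ)..(2 * Real.pi), (‖dθ u t θ‖ ^ 2 - ‖dt T u t θ‖ ^ 2) = 0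

/-- The common assumptions: `u` is a harmonic map from `[0,T] × S¹` to `N` with
`|∇u| + |∇²u| ≤ ε₁^(1/2)`, vanishing Pohozaev integrals, slice norms `a` and `b` at the two ends,
and `∂_θ² u` bounded by `C₂ a` and `C₂ b` on the two end pieces of length one. -/
structure SharpAssumptions {p : ℕ} (N : Set (E p)) (ε₁ C₂ T a b : ℝ) (u : ℝ → ℝ → E p) :
    Prop where
  one_le : 1 ≤ T
  harmonic : IsHarmonicMap N T u
  small : ∀ t ∈ Icc 0 T, ∀ θ, √(gradSq T u t θ) + √(hessSq T u t θ) ≤ √ε₁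
  pohozaev : PohozaevZero T u
  left_norm : √(sliceEnergy T u 0) = a
  right_norm : √(sliceEnergy T u T) = b
  left_bound : ∀ t ∈ Icc 0 1, ∀ θ, ‖dθ (dθ u) t θ‖ ≤ C₂ * a
  left_small : C₂ * a < √ε₁
  right_bound : ∀ t ∈ Icc (T - 1) T, ∀ θ, ‖dθ (dθ u) t θ‖ ≤ C₂ * b
  right_small : C₂ * b ≤ √ε₁

/-- `E₁ = (a e^{2T} - b e^T) / (e^{2T} - 1)`. -/
def E₁ (T a b : ℝ) : ℝ :=
  (a * Real.exp (2 * T) - b * Real.exp T) / (Real.exp (2 * T) - 1)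

/-- `E₂ = (b e^T - a) / (e^{2T} - 1)`. -/
def E₂ (T a b : ℝ) : ℝ :=
  (b * Real.exp T - a) / (Real.exp (2 * T) - 1)

/-- `g` solves `g'' = g` on `[0,T]` with `g(0) = A` and `g(T) = B`. -/
def SolvesBVP (T A B : ℝ) (g : ℝ → ℝ) : Prop :=
  g 0 = A ∧ g T = B ∧ ∃ g' : ℝ → ℝ, ∀ t ∈ Icc 0 T,
    HasDerivWithinAt g (g' t) (Icc 0 T) t ∧ HasDerivWithinAt g' (g t) (Icc 0 T) t

end CylHarmonic

end

/-! Write `S(t)` for the slice energy and `X = √S`. Vanishing Pohozaev integrals give `S =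
2∫|∂_θu|²`. Differentiating twice and integrating by parts in `θ`, then using Wirtinger's inequality
for `∂_θu` (mean zero by periodicity) and `|Δu| ≤ C|∇u|²`, one finds `X'' ≥ (1 - κ)X` where `X > 0`,
with `κ` of the order of `C sup|∇u|` on the slice (`IsHarmonicLike.exists_deriv_energy`). The
constant `C` bounds the second fundamental form of the compact `N`
(`IsClosedSubmanifold.exists_curvatureBound`).

A constant `κ > 0` would spoil the rate `e^{-t}`, so the argument is run twice. With `κ = 3/4` the
maximum principle gives decay like `e^{-d/2}` away from both ends. This is turned into pointwise
decay of `|∇u|`, whence `κ` is at most `(e^{-d₁/4} + e^{-d₂/4})/10`, with `d₁`, `d₂` the distances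
to the ends. The integral of this potential is bounded independently of the length, so `sinh` times
a factor between 1 and 2 is a supersolution (`exists_sinh_supersolution`), and the comparison loses
only the factor 2 (`IsSqrtSubsolution.le_two_mul_sinh`). This is (1). If some slice at distance at
least 2 from the left end carries no less energy than that end, the left term of the `sinh` bound
can be absorbed, which gives (2) (`IsSqrtSubsolution.le_exp_mul_of_le`).

The passage from slice energy to pointwise bounds differs: in (1) and (2) the Hessian bound is
available (`IsHarmonicLike.density_le_of_hessian`); in (3) only the energy is small, and
ε-regularity replaces it, via Bochner's inequality and the mean value inequality
(`IsHarmonicLike.density_le`). Statement (3) then follows from the absorption argument between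
well-chosen slices of `W₂` and `W_{m-1}`. -/

namespace CylHarmonic

/-! ### The second fundamental form of a closed submanifold -/

/-- `A ∘ R` is a small perturbation of the identity, hence bijective. Choosing `q` with `A (R q) = A
w` puts `w - R q` in the kernel, so `‖w‖² = ⟪w, R q⟫`. The bound is uniform for `A` near `A₀`, which
is what makes the curvature estimate locally uniform. -/
theorem norm_le_of_orthogonal_ker {V W : Type*} [NormedAddCommGroup V] [InnerProductSpace ℝ V]
    [NormedAddCommGroup W] [NormedSpace ℝ W] [FiniteDimensional ℝ W] {A₀ A : V →L[ℝ] W}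
    {R : W →L[ℝ] V} (hR : ∀ q, A₀ (R q) = q) (hA : ‖A - A₀‖ * ‖R‖ ≤ 1 / 2) {w : V}
    (hw : ∀ v, A v = 0 → inner ℝ w v = 0) : ‖w‖ ≤ 2 * ‖R‖ * ‖A w‖ := by
  have hlow : ∀ q, ‖q‖ ≤ 2 * ‖A (R q)‖ := by
    intro q
    have h1 : ‖(A - A₀) (R q)‖ ≤ 1 / 2 * ‖q‖ :=
      calc ‖(A - A₀) (R q)‖ ≤ ‖A - A₀‖ * ‖R q‖ := (A - A₀).le_opNorm _
        _ ≤ ‖A - A₀‖ * (‖R‖ * ‖q‖) := by gcongr; exact R.le_opNorm q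
        _ = ‖A - A₀‖ * ‖R‖ * ‖q‖ := by ring
        _ ≤ 1 / 2 * ‖q‖ := by gcongr
    have h2 : q = A (R q) - (A - A₀) (R q) := by simp [hR]
    have h3 : ‖q‖ ≤ ‖A (R q)‖ + ‖(A - A₀) (R q)‖ := by
      conv_lhs => rw [h2]
      exact norm_sub_le _ _
    linarith
  have hinj : Function.Injective (A ∘L R : W →ₗ[ℝ] W) := by
    rw [← LinearMap.ker_eq_bot, LinearMap.ker_eq_bot']
    intro q hq
    have h := hlow q
    have hq' : A (R q) = 0 := hq
    rw [hq', norm_zero, mul_zero] at h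
    exact norm_le_zero_iff.1 h
  obtain ⟨q, hq⟩ := LinearMap.surjective_of_injective hinj (A w)
  have hq' : A (R q) = A w := hq
  have horth : inner ℝ w (w - R q) = 0 := hw _ (by simp [hq'])
  have h1 : ‖w‖ ^ 2 ≤ ‖w‖ * ‖R q‖ := by
    rw [inner_sub_right, real_inner_self_eq_norm_sq] at horth
    linarith [real_inner_le_norm w (R q)]
  have h2 : ‖R q‖ ≤ 2 * ‖R‖ * ‖A w‖ := by
    have := hlow q
    rw [hq'] at this
    calc ‖R q‖ ≤ ‖R‖ * ‖q‖ := R.le_opNorm q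
      _ ≤ ‖R‖ * (2 * ‖A w‖) := by gcongr
      _ = _ := by ring
  rcases (norm_nonneg w).eq_or_lt with h0 | h0
  · rw [← h0]; positivity
  · exact (le_of_mul_le_mul_left (by linarith [h1, sq ‖w‖]) h0).trans h2

/-- The implicit function `φ` parametrises the level set by the kernel, and `s ↦ φ (s • v)` is a
curve in `N` with velocity `v`. -/
theorem mem_tangentVectors_of_fderiv_eq_zero {p k : ℕ} {N U : Set (E p)} {F : E p → E k}
    (hU : IsOpen U) (hF : ContDiffOn ℝ ∞ F U) (hN : N ∩ U = {y ∈ U | F y = 0}) {y : E p}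
    (hy : y ∈ N ∩ U) (hs : Function.Surjective (fderiv ℝ F y)) {v : E p}
    (hv : fderiv ℝ F y v = 0) : v ∈ tangentVectors N y := by
  have hFy : F y = 0 := (hN ▸ hy : y ∈ {y ∈ U | F y = 0}).2
  have hstrict : HasStrictFDerivAt F (fderiv ℝ F y) y :=
    (hF.contDiffAt (hU.mem_nhds hy.2)).hasStrictFDerivAt (by simp)
  have hrange : (fderiv ℝ F y).range = ⊤ := LinearMap.range_eq_top.2 hs
  let v' : (fderiv ℝ F y).ker := ⟨v, hv⟩
  let φ := hstrict.implicitFunction F (fderiv ℝ F y) hrange (F y)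
  have hφ : HasStrictFDerivAt φ (fderiv ℝ F y).ker.subtypeL 0 :=
    hstrict.to_implicitFunction hrange
  have hφ0 : φ 0 = y := hstrict.implicitFunction_apply_image hrange
  have hline : HasDerivAt (fun s : ℝ => s • v') v' 0 := by
    simpa using (hasDerivAt_id (0 : ℝ)).smul_const v'
  have hγ : HasDerivAt (fun s : ℝ => φ (s • v')) v 0 := by
    have h0 : HasFDerivAt φ (fderiv ℝ F y).ker.subtypeL ((0 : ℝ) • v') := by
      rw [zero_smul]; exact hφ.hasFDerivAt
    exact h0.comp_hasDerivAt (0 : ℝ) hline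
  refine ⟨fun s => φ (s • v'), by simp [hφ0], ?_, hγ⟩
  have hcont : ContinuousAt (fun s : ℝ => φ (s • v')) 0 := hγ.continuousAt
  have hlineT : Tendsto (fun s : ℝ => (F y, s • v')) (𝓝 0) (𝓝 (F y, 0)) := by
    have : Tendsto (fun s : ℝ => s • v') (𝓝 0) (𝓝 0) := by
      simpa using hline.continuousAt.tendsto
    exact tendsto_const_nhds.prodMk_nhds this
  have hU' : ∀ᶠ s in 𝓝 (0 : ℝ), φ (s • v') ∈ U :=
    hcont.eventually_mem (hU.mem_nhds (by simpa [hφ0] using hy.2))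
  filter_upwards [hU', hlineT.eventually (hstrict.map_implicitFunction_eq hrange)] with s h1 h2
  have : φ (s • v') ∈ {y ∈ U | F y = 0} := ⟨h1, h2.trans hFy⟩
  rw [← hN] at this
  exact this.1

/-- This is the second derivative of `F ∘ α = 0`: the normal part of an acceleration is quadratic in
the velocity. -/
theorem fderiv_apply_second_deriv {p k : ℕ} {N U : Set (E p)} {F : E p → E k}
    (hU : IsOpen U) (hF : ContDiffOn ℝ ∞ F U) (hN : N ∩ U = {y ∈ U | F y = 0})
    {α α' : ℝ → E p} {α'' : E p} (hαU : α 0 ∈ U) (hαN : ∀ᶠ s in 𝓝 (0 : ℝ), α s ∈ N)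
    (hα : ∀ᶠ s in 𝓝 (0 : ℝ), HasDerivAt α (α' s) s) (hα' : HasDerivAt α' α'' 0) :
    fderiv ℝ F (α 0) α'' = -(fderiv ℝ (fderiv ℝ F) (α 0) (α' 0) (α' 0)) := by
  have hU' : ∀ᶠ s in 𝓝 (0 : ℝ), α s ∈ U :=
    hα.self_of_nhds.continuousAt.eventually_mem (hU.mem_nhds hαU)
  have hzero : ∀ᶠ s in 𝓝 (0 : ℝ), F (α s) = 0 := by
    filter_upwards [hU', hαN] with s h1 h2
    have : α s ∈ N ∩ U := ⟨h2, h1⟩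
    rw [hN] at this
    exact this.2
  have hfirst : ∀ᶠ s in 𝓝 (0 : ℝ), fderiv ℝ F (α s) (α' s) = 0 := by
    filter_upwards [hzero.eventually_nhds, hU', hα] with s h1 h2 h3
    have hd : DifferentiableAt ℝ F (α s) :=
      (hF.contDiffAt (hU.mem_nhds h2)).differentiableAt (by simp)
    have h4 : HasDerivAt (fun s => F (α s)) (fderiv ℝ F (α s) (α' s)) s :=
      hd.hasFDerivAt.comp_hasDerivAt s h3
    have h5 : HasDerivAt (fun s => F (α s)) 0 s :=
      (hasDerivAt_const s (0 : E k)).congr_of_eventuallyEq h1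
    exact h4.unique h5
  have hd2 : DifferentiableAt ℝ (fderiv ℝ F) (α 0) :=
    ((hF.contDiffAt (hU.mem_nhds hαU)).fderiv_right (m := 1) (by norm_cast)).differentiableAt
      (by simp)
  have h6 : HasDerivAt (fun s => fderiv ℝ F (α s))
      (fderiv ℝ (fderiv ℝ F) (α 0) (α' 0)) 0 :=
    hd2.hasFDerivAt.comp_hasDerivAt (0 : ℝ) hα.self_of_nhds
  have h7 := h6.clm_apply hα'
  have h8 : HasDerivAt (fun s => fderiv ℝ F (α s) (α' s)) 0 0 :=
    (hasDerivAt_const (0 : ℝ) (0 : E k)).congr_of_eventuallyEq hfirst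
  exact eq_neg_of_add_eq_zero_right (h7.unique h8)

/-- For two curves in `N` through a point of `V` whose accelerations add up to a normal vector, the
sum of the accelerations is at most `C` times the sum of the squared speeds. -/
def HasCurvatureBound {p : ℕ} (N V : Set (E p)) (C : ℝ) : Prop :=
  ∀ (α α' β β' : ℝ → E p) (α'' β'' : E p), α 0 ∈ V → β 0 = α 0 →
    (∀ᶠ s in 𝓝 (0 : ℝ), α s ∈ N) → (∀ᶠ s in 𝓝 (0 : ℝ), HasDerivAt α (α' s) s) →
    HasDerivAt α' α'' 0 →
    (∀ᶠ s in 𝓝 (0 : ℝ), β s ∈ N) → (∀ᶠ s in 𝓝 (0 : ℝ), HasDerivAt β (β' s) s) →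
    HasDerivAt β' β'' 0 →
    (∀ v ∈ tangentVectors N (α 0), inner ℝ (α'' + β'') v = 0) →
    ‖α'' + β''‖ ≤ C * (‖α' 0‖ ^ 2 + ‖β' 0‖ ^ 2)

/-- A normal vector is orthogonal to `ker DF`, so it is controlled by its image under `DF`; for the
sum of the accelerations this image is `-D²F` evaluated on the two velocities. -/
theorem exists_local_curvatureBound {p k : ℕ} {N U : Set (E p)} {F : E p → E k} {x : E p}
    (hU : IsOpen U) (hxU : x ∈ U) (hF : ContDiffOn ℝ ∞ F U) (hx : x ∈ N)
    (hN : N ∩ U = {y ∈ U | F y = 0})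
    (hs : ∀ y ∈ N ∩ U, Function.Surjective (fderiv ℝ F y)) :
    ∃ V ∈ 𝓝 x, ∃ C : ℝ, HasCurvatureBound N V C := by
  obtain ⟨R₀, hR₀⟩ := (fderiv ℝ F x : E p →ₗ[ℝ] E k).exists_rightInverse_of_surjective
    (LinearMap.range_eq_top.2 (hs x ⟨hx, hxU⟩))
  let R : E k →L[ℝ] E p := LinearMap.toContinuousLinearMap R₀
  have hR : ∀ q, fderiv ℝ F x (R q) = q := fun q => LinearMap.congr_fun hR₀ q
  have hcd : ContDiffAt ℝ 1 (fderiv ℝ F) x :=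
    (hF.contDiffAt (hU.mem_nhds hxU)).fderiv_right (m := 1) (by norm_cast)
  have hc1 : ContinuousAt (fderiv ℝ F) x := hcd.continuousAt
  have hc2 := (hcd.fderiv_right (m := 0) (by norm_num)).continuousAt.norm
  have hev1 : ∀ᶠ y in 𝓝 x, ‖fderiv ℝ F y - fderiv ℝ F x‖ * ‖R‖ < 1 / 2 := by
    have : ContinuousAt (fun y => ‖fderiv ℝ F y - fderiv ℝ F x‖ * ‖R‖) x :=
      (hc1.sub continuousAt_const).norm.mul continuousAt_const
    exact this.eventually_lt continuousAt_const (by simp)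
  have hev2 : ∀ᶠ y in 𝓝 x, ‖fderiv ℝ (fderiv ℝ F) y‖ < ‖fderiv ℝ (fderiv ℝ F) x‖ + 1 := 
    hc2.eventually_lt continuousAt_const (lt_add_one _)
  refine ⟨_, hev1.and (hev2.and (hU.mem_nhds hxU)),
    2 * ‖R‖ * (‖fderiv ℝ (fderiv ℝ F) x‖ + 1), ?_⟩
  rintro α α' β β' α'' β'' ⟨hy1, hy2, hyU⟩ hβα hαN hα hα' hβN hβ hβ' hnorm
  have hyN : α 0 ∈ N ∩ U := ⟨hαN.self_of_nhds, hyU⟩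
  have h1 := norm_le_of_orthogonal_ker hR (le_of_lt hy1) (w := α'' + β'') fun v hv =>
    hnorm v (mem_tangentVectors_of_fderiv_eq_zero hU hF hN hyN (hs _ hyN) hv)
  have h2 := fderiv_apply_second_deriv hU hF hN hyU hαN hα hα'
  have h3 := fderiv_apply_second_deriv hU hF hN (hβα ▸ hyU) hβN hβ hβ'
  rw [hβα] at h3
  set B := fderiv ℝ (fderiv ℝ F) (α 0)
  have hB : ∀ v, ‖B v v‖ ≤ (‖fderiv ℝ (fderiv ℝ F) x‖ + 1) * ‖v‖ ^ 2 := fun v =>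
    calc ‖B v v‖ ≤ ‖B‖ * ‖v‖ * ‖v‖ := B.le_opNorm₂ v v
      _ = ‖B‖ * ‖v‖ ^ 2 := by ring
      _ ≤ _ := by gcongr
  have h4 : ‖fderiv ℝ F (α 0) (α'' + β'')‖ ≤
      (‖fderiv ℝ (fderiv ℝ F) x‖ + 1) * (‖α' 0‖ ^ 2 + ‖β' 0‖ ^ 2) := by
    rw [map_add, h2, h3]
    refine (norm_add_le _ _).trans ?_
    rw [norm_neg, norm_neg]
    linarith [hB (α' 0), hB (β' 0)]
  calc ‖α'' + β''‖ ≤ 2 * ‖R‖ * ‖fderiv ℝ F (α 0) (α'' + β'')‖ := h1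
    _ ≤ 2 * ‖R‖ * ((‖fderiv ℝ (fderiv ℝ F) x‖ + 1) * (‖α' 0‖ ^ 2 + ‖β' 0‖ ^ 2)) := by gcongr
    _ = _ := by ring

/-- Compactness passes from local constants to one constant for `N`. The normalisation `1 ≤ C` is
for convenience only. -/
theorem IsClosedSubmanifold.exists_curvatureBound {p n : ℕ} {N : Set (E p)}
    (hN : IsClosedSubmanifold n N) : ∃ C : ℝ, 1 ≤ C ∧ HasCurvatureBound N N C := by
  obtain ⟨hK, k, -, hloc⟩ := hN
  suffices h : ∃ C : ℝ, HasCurvatureBound N N C by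
    obtain ⟨C, hC⟩ := h
    refine ⟨max C 1, le_max_right _ _, ?_⟩
    intro α α' β β' α'' β'' h0 h1 h2 h3 h4 h5 h6 h7 h8
    refine (hC α α' β β' α'' β'' h0 h1 h2 h3 h4 h5 h6 h7 h8).trans ?_
    gcongr
    exact le_max_left _ _
  refine hK.induction_on (p := fun V => ∃ C : ℝ, HasCurvatureBound N V C) ?_ ?_ ?_ ?_
  · exact ⟨0, fun _ _ _ _ _ _ h => h.elim⟩
  · rintro s t hst ⟨C, hC⟩
    exact ⟨C, fun α α' β β' α'' β'' h => hC α α' β β' α'' β'' (hst h)⟩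
  · rintro s t ⟨C, hC⟩ ⟨C', hC'⟩
    refine ⟨max C C', ?_⟩
    rintro α α' β β' α'' β'' (h | h) h1 h2 h3 h4 h5 h6 h7 h8
    · refine (hC α α' β β' α'' β'' h h1 h2 h3 h4 h5 h6 h7 h8).trans ?_
      gcongr
      exact le_max_left _ _
    · refine (hC' α α' β β' α'' β'' h h1 h2 h3 h4 h5 h6 h7 h8).trans ?_
      gcongr
      exact le_max_right _ _
  · intro x hx
    obtain ⟨U, F, hU, hxU, hF, hNU, hs⟩ := hloc x hx
    obtain ⟨V, hV, C, hC⟩ := exists_local_curvatureBound hU hxU hF hx hNU hs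
    exact ⟨V, mem_nhdsWithin_of_mem_nhds hV, C, hC⟩

/-! ### Comparison principles on an interval -/

/-- At a positive interior maximum a positive second derivative forces a local minimum as well, so
`h` is locally constant, a contradiction. Differentiability is asked only where `h > 0`, because
`√S` need not be differentiable at zeros of `S`. -/
theorem nonpos_of_second_deriv_pos {α β : ℝ} {h : ℝ → ℝ} (hc : ContinuousOn h (Icc α β))
    (hα : h α ≤ 0) (hβ : h β ≤ 0)
    (hpos : ∀ t ∈ Ioo α β, 0 < h t → ∃ h' : ℝ → ℝ, (∀ᶠ s in 𝓝 t, HasDerivAt h (h' s) s) ∧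
      ∃ d, 0 < d ∧ HasDerivAt h' d t) :
    ∀ t ∈ Icc α β, h t ≤ 0 := by
  intro t ht
  by_contra! hlt
  obtain ⟨m, hm, hmax⟩ := isCompact_Icc.exists_isMaxOn ⟨t, ht⟩ hc
  have hm0 : 0 < h m := hlt.trans_le (hmax ht)
  have hmI : m ∈ Ioo α β := by
    refine ⟨lt_of_le_of_ne hm.1 ?_, lt_of_le_of_ne hm.2 ?_⟩
    · rintro rfl; linarith
    · rintro rfl; linarith
  obtain ⟨h', hh', d, hd, hd'⟩ := hpos m hmI hm0
  have hlmax : IsLocalMax h m := hmax.isLocalMax (Icc_mem_nhds hmI.1 hmI.2)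
  have hderiv : deriv h =ᶠ[𝓝 m] h' := hh'.mono fun s hs => hs.deriv
  have hlmin : IsLocalMin h m := by
    refine isLocalMin_of_deriv_deriv_pos ?_ hlmax.deriv_eq_zero hh'.self_of_nhds.continuousAt
    rw [hderiv.deriv_eq, hd'.deriv]
    exact hd
  have hconst : h =ᶠ[𝓝 m] fun _ => h m := by
    filter_upwards [hlmax, hlmin] with s h1 h2
    exact le_antisymm h1 h2
  have hz : h' =ᶠ[𝓝 m] fun _ => 0 := by
    filter_upwards [hconst.eventually_nhds, hh'] with s h1 h2
    exact h2.unique ((hasDerivAt_const s (h m)).congr_of_eventuallyEq h1)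
  exact hd.ne' (hd'.unique ((hasDerivAt_const m (0 : ℝ)).congr_of_eventuallyEq hz))

/-- `√S` is a subsolution of `X'' = (1 - κ) X` on `[α, β]` away from its zeros. -/
structure IsSqrtSubsolution (α β : ℝ) (κ S : ℝ → ℝ) : Prop where
  continuousOn : ContinuousOn S (Icc α β)
  nonneg : ∀ t ∈ Icc α β, 0 ≤ S t
  exists_deriv : ∃ S₁ S₂ : ℝ → ℝ, ∀ t ∈ Ioo α β, HasDerivAt S (S₁ t) t ∧ HasDerivAt S₁ (S₂ t) t ∧
    (0 < S t → 4 * (1 - κ t) * S t ^ 2 ≤ 2 * S t * S₂ t - S₁ t ^ 2)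

/-- Where `√S > w ≥ 0`, the condition `κ < 1` makes `(√S - w)'' ≥ (1 - κ)(√S - w)` strictly
positive, which the maximum principle excludes. -/
theorem IsSqrtSubsolution.le_supersolution {α β : ℝ} {κ S : ℝ → ℝ}
    (hS : IsSqrtSubsolution α β κ S) {w w₁ w₂ : ℝ → ℝ} (hwc : ContinuousOn w (Icc α β))
    (hw : ∀ t ∈ Ioo α β, HasDerivAt w (w₁ t) t) (hw₁ : ∀ t ∈ Ioo α β, HasDerivAt w₁ (w₂ t) t)
    (hκ : ∀ t ∈ Ioo α β, κ t < 1) (hw₂ : ∀ t ∈ Ioo α β, w₂ t ≤ (1 - κ t) * w t)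
    (hα : √(S α) ≤ w α) (hβ : √(S β) ≤ w β) (hw0 : ∀ t ∈ Ioo α β, 0 ≤ w t) :
    ∀ t ∈ Icc α β, √(S t) ≤ w t := by
  obtain ⟨S₁, S₂, hd⟩ := hS.exists_deriv
  intro t ht
  refine sub_nonpos.1 (nonpos_of_second_deriv_pos (h := fun t => √(S t) - w t)
    (hS.continuousOn.sqrt.sub hwc) (sub_nonpos.2 hα) (sub_nonpos.2 hβ) ?_ t ht)
  intro s hs hpos
  have hr : 0 < √(S s) := by linarith [hw0 s hs]
  have hS0 : 0 < S s := Real.sqrt_pos.1 hr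
  refine ⟨fun x => S₁ x / (2 * √(S x)) - w₁ x, ?_,
    (S₂ s * (2 * √(S s)) - S₁ s * (2 * (S₁ s / (2 * √(S s))))) / (2 * √(S s)) ^ 2 - w₂ s, ?_, ?_⟩
  · filter_upwards [isOpen_Ioo.mem_nhds hs,
      (hd s hs).1.continuousAt.eventually_const_lt hS0] with x hx hx0
    exact ((hd x hx).1.sqrt hx0.ne').sub (hw x hx)
  · have key := (hd s hs).2.2 hS0
    have h2 := hw₂ s hs
    have h3 := hκ s hs
    have h4 : (1 - κ s) * w s < (1 - κ s) * √(S s) := by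
      apply mul_lt_mul_of_pos_left <;> linarith
    have hsq : S s = √(S s) ^ 2 := (Real.sq_sqrt hS0.le).symm
    set r := √(S s)
    rw [hsq] at key
    -- The quotient is `(√S)''` as produced by the quotient rule; with `r = √S` it satisfies `4r³
    -- r'' = 2 S S'' - S'²`.
    have h5 : (1 - κ s) * r ≤ (S₂ s * (2 * r) - S₁ s * (2 * (S₁ s / (2 * r)))) / (2 * r) ^ 2 := by
      have h6 : (S₂ s * (2 * r) - S₁ s * (2 * (S₁ s / (2 * r)))) / (2 * r) ^ 2 =
          (2 * r ^ 2 * S₂ s - S₁ s ^ 2) / (4 * r ^ 3) := by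
        field_simp
        ring
      rw [h6, le_div_iff₀ (by positivity)]
      calc (1 - κ s) * r * (4 * r ^ 3) = 4 * (1 - κ s) * (r ^ 2) ^ 2 := by ring
        _ ≤ _ := key
    linarith
  · exact ((hd s hs).2.1.div (((hd s hs).1.sqrt hS0.ne').const_mul 2) (by positivity)).sub
      (hw₁ s hs)

/-- Exponential decay at half the sharp rate. -/
theorem IsSqrtSubsolution.le_exp {α β : ℝ} {S : ℝ → ℝ}
    (hS : IsSqrtSubsolution α β (fun _ => 3 / 4) S) :
    ∀ t ∈ Icc α β, √(S t) ≤
      √(S α) * Real.exp (-(t - α) / 2) + √(S β) * Real.exp (-(β - t) / 2) := by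
  have he1 : ∀ t, HasDerivAt (fun t => Real.exp (-(t - α) / 2))
      (-(1 / 2) * Real.exp (-(t - α) / 2)) t := fun t => by
    exact (((hasDerivAt_id' t).sub_const α).fun_neg.div_const 2).exp.congr_deriv (by ring)
  have he2 : ∀ t, HasDerivAt (fun t => Real.exp (-(β - t) / 2))
      ((1 / 2) * Real.exp (-(β - t) / 2)) t := fun t => by
    exact (((hasDerivAt_id' t).const_sub β).fun_neg.div_const 2).exp.congr_deriv (by ring)
  have hd : ∀ t, HasDerivAt
      (fun t => √(S α) * Real.exp (-(t - α) / 2) + √(S β) * Real.exp (-(β - t) / 2))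
      (√(S α) * (-(1 / 2) * Real.exp (-(t - α) / 2)) +
        √(S β) * ((1 / 2) * Real.exp (-(β - t) / 2))) t := fun t =>
    ((he1 t).const_mul _).add ((he2 t).const_mul _)
  refine hS.le_supersolution (fun t _ => (hd t).continuousAt.continuousWithinAt)
    (fun t _ => hd t) (fun t _ => (((he1 t).const_mul (-(1 / 2))).const_mul (√(S α))).add
      (((he2 t).const_mul (1 / 2)).const_mul (√(S β)))) (fun _ _ => by norm_num)
    -- Both exponentials solve `w'' = w/4` exactly, matching `κ = 3/4`.
    (fun t _ => le_of_eq (by ring)) ?_ ?_ (fun t _ => by positivity)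
  · simp; positivity
  · simp; positivity

/-- The potential `(e^{-x/4} + e^{-(τ-x)/4}) / 10`. -/
noncomputable def smallPotential (τ x : ℝ) : ℝ :=
  1 / 10 * (Real.exp (-x / 4) + Real.exp (-(τ - x) / 4))

theorem smallPotential_lt_one {τ x : ℝ} (hx : x ∈ Icc 0 τ) : smallPotential τ x < 1 := by
  have h1 : Real.exp (-x / 4) ≤ 1 := Real.exp_le_one_iff.2 (by linarith [hx.1])
  have h2 : Real.exp (-(τ - x) / 4) ≤ 1 := Real.exp_le_one_iff.2 (by linarith [hx.2])
  rw [smallPotential]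
  linarith

/-- `sinh (τ - x)` admits a multiple between `1` and `2` that is a supersolution of
`w'' = (1 - smallPotential τ) w`. -/
theorem exists_sinh_supersolution (τ : ℝ) : ∃ P P₁ P₂ : ℝ → ℝ,
    (∀ x, HasDerivAt P (P₁ x) x) ∧ (∀ x, HasDerivAt P₁ (P₂ x) x) ∧
    ∀ x ∈ Icc 0 τ, Real.sinh (τ - x) ≤ P x ∧ P x ≤ 2 * Real.sinh (τ - x) ∧
      P₂ x ≤ (1 - smallPotential τ x) * P x := by
  have he1 : ∀ x, HasDerivAt (fun x => Real.exp (-x / 4)) (-(1 / 4) * Real.exp (-x / 4)) x :=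
    fun x => by
      exact ((hasDerivAt_id' x).fun_neg.div_const 4).exp.congr_deriv (by ring)
  have he2 : ∀ x, HasDerivAt (fun x => Real.exp (-(τ - x) / 4))
      ((1 / 4) * Real.exp (-(τ - x) / 4)) x := fun x => by
    exact (((hasDerivAt_id' x).const_sub τ).fun_neg.div_const 4).exp.congr_deriv (by ring)
  have hs : ∀ x, HasDerivAt (fun x => Real.sinh (τ - x)) (-Real.cosh (τ - x)) x := fun x => by
    exact ((hasDerivAt_id' x).const_sub τ).sinh.congr_deriv (by ring)
  have hch : ∀ x, HasDerivAt (fun x => -Real.cosh (τ - x)) (Real.sinh (τ - x)) x := fun x => by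
    exact ((hasDerivAt_id' x).const_sub τ).cosh.fun_neg.congr_deriv (by ring)
  -- The correction factor is increasing with `φ 0 = 1` and `φ ≤ 1 + 32/35`. Its derivative is a
  -- multiple of the potential, and the coefficient `4/35` is chosen so that `φ'' - 2φ' = -(9p +
  -- 7q)/35 ≤ -(p + q)/5`, with `p`, `q` the two exponentials; this is `-2` times the potential.
  let φ : ℝ → ℝ := fun x => 1 + 16 / 35 * (1 - Real.exp (-x / 4) +
    Real.exp (-(τ - x) / 4) - Real.exp (-τ / 4))
  let φ₁ : ℝ → ℝ := fun x => 4 / 35 * (Real.exp (-x / 4) + Real.exp (-(τ - x) / 4))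
  let φ₂ : ℝ → ℝ := fun x => 1 / 35 * (-Real.exp (-x / 4) + Real.exp (-(τ - x) / 4))
  have hφ : ∀ x, HasDerivAt φ (φ₁ x) x := fun x => by
    exact (((((he1 x).const_sub 1).add (he2 x)).sub_const (Real.exp (-τ / 4))).const_mul
      (16 / 35) |>.const_add 1).congr_deriv (by simp only [φ₁]; ring)
  have hφ₁ : ∀ x, HasDerivAt φ₁ (φ₂ x) x := fun x => by
    exact (((he1 x).add (he2 x)).const_mul (4 / 35)).congr_deriv (by simp only [φ₂]; ring)
  refine ⟨fun x => Real.sinh (τ - x) * φ x,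
    fun x => -Real.cosh (τ - x) * φ x + Real.sinh (τ - x) * φ₁ x,
    fun x => (Real.sinh (τ - x) * φ x + -Real.cosh (τ - x) * φ₁ x) +
      (-Real.cosh (τ - x) * φ₁ x + Real.sinh (τ - x) * φ₂ x),
    fun x => (hs x).mul (hφ x),
    fun x => ((hch x).mul (hφ x)).add ((hs x).mul (hφ₁ x)), ?_⟩
  intro x hx
  have hsn : 0 ≤ Real.sinh (τ - x) := Real.sinh_nonneg_iff.2 (by linarith [hx.2])
  have hcs : Real.sinh (τ - x) ≤ Real.cosh (τ - x) := (Real.sinh_lt_cosh _).le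
  have h1 : Real.exp (-x / 4) ≤ 1 := Real.exp_le_one_iff.2 (by linarith [hx.1])
  have h2 : Real.exp (-(τ - x) / 4) ≤ 1 := Real.exp_le_one_iff.2 (by linarith [hx.2])
  have h3 : Real.exp (-τ / 4) ≤ Real.exp (-(τ - x) / 4) := Real.exp_le_exp.2 (by linarith [hx.1])
  have h4 := Real.exp_pos (-x / 4)
  have h5 := Real.exp_pos (-(τ - x) / 4)
  have h6 := Real.exp_pos (-τ / 4)
  have hφl : 1 ≤ φ x := by simp only [φ]; linarith
  have hφu : φ x ≤ 2 := by simp only [φ]; linarith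
  refine ⟨le_mul_of_one_le_right hsn hφl, by nlinarith, ?_⟩
  have hφ₁0 : 0 ≤ φ₁ x := by simp only [φ₁]; positivity
  have hk : 0 ≤ smallPotential τ x := by rw [smallPotential]; positivity
  -- Since `φ' ≥ 0` and `cosh ≥ sinh`, one has `(sinh · φ)'' ≤ sinh · (φ + φ'' - 2φ')`, so this
  -- inequality is all that is needed; the bound `φ ≤ 2` reduces it to the choice of constants
  -- above.
  have h7 : φ₂ x - 2 * φ₁ x ≤ -(smallPotential τ x * φ x) := by
    have h8 : smallPotential τ x * φ x ≤ smallPotential τ x * 2 := by gcongr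
    have h9 : φ₂ x - 2 * φ₁ x ≤ -(smallPotential τ x * 2) := by
      simp only [φ₁, φ₂, smallPotential]; linarith
    linarith
  have h10 := mul_le_mul_of_nonneg_left h7 hsn
  have h11 := mul_le_mul_of_nonneg_right hcs hφ₁0
  linarith

/-- Decay at the sharp rate, with the constant `2`. -/
theorem IsSqrtSubsolution.le_two_mul_sinh {α β : ℝ} (hαβ : α < β) {S : ℝ → ℝ}
    (hS : IsSqrtSubsolution α β (fun t => smallPotential (β - α) (t - α)) S) :
    ∀ t ∈ Icc α β, √(S t) ≤ 2 * ((√(S α) * Real.sinh (β - t) + √(S β) * Real.sinh (t - α)) /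
      Real.sinh (β - α)) := by
  obtain ⟨P, P₁, P₂, hP, hP₁, hb⟩ := exists_sinh_supersolution (β - α)
  have hs : 0 < Real.sinh (β - α) := Real.sinh_pos_iff.2 (sub_pos.2 hαβ)
  have hdα : ∀ t, HasDerivAt (fun t => P (t - α)) (P₁ (t - α)) t := fun t =>
    (hP (t - α)).comp_sub_const t α
  have hdβ : ∀ t, HasDerivAt (fun t => P (β - t)) (-P₁ (β - t)) t := fun t =>
    (hP (β - t)).comp_const_sub β t
  have hdα₁ : ∀ t, HasDerivAt (fun t => P₁ (t - α)) (P₂ (t - α)) t := fun t =>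
    (hP₁ (t - α)).comp_sub_const t α
  have hdβ₁ : ∀ t, HasDerivAt (fun t => -P₁ (β - t)) (P₂ (β - t)) t := fun t => by
    simpa using ((hP₁ (β - t)).comp_const_sub β t).fun_neg
  have hd : ∀ t, HasDerivAt
      (fun t => (√(S α) * P (t - α) + √(S β) * P (β - t)) / Real.sinh (β - α))
      ((√(S α) * P₁ (t - α) + √(S β) * -P₁ (β - t)) / Real.sinh (β - α)) t := fun t =>
    (((hdα t).const_mul _).add ((hdβ t).const_mul _)).div_const _
  have hd₁ : ∀ t, HasDerivAt
      (fun t => (√(S α) * P₁ (t - α) + √(S β) * -P₁ (β - t)) / Real.sinh (β - α))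
      ((√(S α) * P₂ (t - α) + √(S β) * P₂ (β - t)) / Real.sinh (β - α)) t := fun t =>
    (((hdα₁ t).const_mul _).add ((hdβ₁ t).const_mul _)).div_const _
  have hmem1 : ∀ t ∈ Icc α β, t - α ∈ Icc 0 (β - α) := fun t ht =>
    ⟨by linarith [ht.1], by linarith [ht.2]⟩
  have hmem2 : ∀ t ∈ Icc α β, β - t ∈ Icc 0 (β - α) := fun t ht =>
    ⟨by linarith [ht.2], by linarith [ht.1]⟩
  -- The potential is invariant under reflection of the interval, so the same `P` serves both ends.
  have hsym : ∀ t, smallPotential (β - α) (β - t) = smallPotential (β - α) (t - α) := fun t => by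
    rw [smallPotential, smallPotential, add_comm]
    congr 4 <;> ring
  have hPpos : ∀ x ∈ Icc 0 (β - α), 0 ≤ P x := fun x hx =>
    (Real.sinh_nonneg_iff.2 (by linarith [hx.2])).trans (hb x hx).1
  intro t ht
  refine (hS.le_supersolution (fun t _ => (hd t).continuousAt.continuousWithinAt)
    (fun t _ => hd t) (fun t _ => hd₁ t)
    (fun t ht => smallPotential_lt_one (hmem1 t (Ioo_subset_Icc_self ht))) ?_ ?_ ?_ ?_ t ht).trans ?_
  · intro t ht
    have ht' := Ioo_subset_Icc_self ht
    have h1 := (hb _ (hmem1 t ht')).2.2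
    have h2 := (hb _ (hmem2 t ht')).2.2
    rw [hsym] at h2
    rw [← mul_div_assoc]
    gcongr
    nlinarith [mul_le_mul_of_nonneg_left h1 (Real.sqrt_nonneg (S α)),
      mul_le_mul_of_nonneg_left h2 (Real.sqrt_nonneg (S β))]
  · rw [le_div_iff₀ hs]
    have h1 := (hb _ (hmem1 α ⟨le_rfl, hαβ.le⟩)).1
    have h2 := hPpos _ (hmem2 α ⟨le_rfl, hαβ.le⟩)
    rw [sub_self, sub_zero] at h1
    rw [sub_self]
    nlinarith [mul_le_mul_of_nonneg_left h1 (Real.sqrt_nonneg (S α)),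
      mul_nonneg (Real.sqrt_nonneg (S β)) h2]
  · rw [le_div_iff₀ hs]
    have h1 := (hb _ (hmem2 β ⟨hαβ.le, le_rfl⟩)).1
    have h2 := hPpos _ (hmem1 β ⟨hαβ.le, le_rfl⟩)
    rw [sub_self, sub_zero] at h1
    rw [sub_self]
    nlinarith [mul_le_mul_of_nonneg_left h1 (Real.sqrt_nonneg (S β)),
      mul_nonneg (Real.sqrt_nonneg (S α)) h2]
  · intro t ht
    have h1 := hPpos _ (hmem1 t (Ioo_subset_Icc_self ht))
    have h2 := hPpos _ (hmem2 t (Ioo_subset_Icc_self ht))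
    positivity
  · rw [← mul_div_assoc]
    gcongr
    have h1 := (hb _ (hmem1 t ht)).2.1
    have h2 := (hb _ (hmem2 t ht)).2.1
    rw [show β - α - (t - α) = β - t by ring] at h1
    rw [show β - α - (β - t) = t - α by ring] at h2
    nlinarith [mul_le_mul_of_nonneg_left h1 (Real.sqrt_nonneg (S α)),
      mul_le_mul_of_nonneg_left h2 (Real.sqrt_nonneg (S β))]

/-- Growth at one slice forces growth at the sharp rate. -/
theorem IsSqrtSubsolution.le_exp_mul_of_le {α β : ℝ} {S : ℝ → ℝ}
    (hS : IsSqrtSubsolution α β (fun t => smallPotential (β - α) (t - α)) S) {t : ℝ}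
    (hαt : α + 2 ≤ t) (htβ : t ≤ β) (hle : S α ≤ S t) :
    S α ≤ 64 * Real.exp (2 * (t - α)) * Real.exp (-2 * (β - α)) * S β := by
  have hαβ : α < β := by linarith
  have key := hS.le_two_mul_sinh hαβ t ⟨by linarith, htβ⟩
  have hα0 := hS.nonneg α ⟨le_rfl, hαβ.le⟩
  have hβ0 := hS.nonneg β ⟨hαβ.le, le_rfl⟩
  have hle' : √(S α) ≤ √(S t) := Real.sqrt_le_sqrt hle
  set a := √(S α)
  set b := √(S β)
  have ha : 0 ≤ a := Real.sqrt_nonneg _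
  have hb : 0 ≤ b := Real.sqrt_nonneg _
  obtain ⟨d, hd⟩ : ∃ d, d = t - α := ⟨_, rfl⟩
  obtain ⟨τ, hτ⟩ : ∃ τ, τ = β - α := ⟨_, rfl⟩
  rw [← hd, ← hτ, show β - t = τ - d by rw [hd, hτ]; ring] at key
  rw [← hd, ← hτ]
  have hd2 : 2 ≤ d := by linarith
  have hτd : d ≤ τ := by linarith
  have hs : 0 < Real.sinh τ := Real.sinh_pos_iff.2 (by linarith)
  -- Here `d ≥ 2` enters, through `e^d ≥ 4`: after the factor 2 of the comparison, half of `a sinh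
  -- τ` remains on the left.
  have h1 : Real.sinh (τ - d) ≤ 1 / 4 * Real.sinh τ := by
    have h2 : 4 * Real.exp (τ - d) ≤ Real.exp τ := by
      have h4 : (4 : ℝ) ≤ Real.exp d := by
        have h5 : Real.exp 1 * Real.exp 1 ≤ Real.exp d := by
          rw [← Real.exp_add]; exact Real.exp_le_exp.2 (by linarith)
        have := Real.add_one_le_exp (1 : ℝ)
        nlinarith
      calc 4 * Real.exp (τ - d) ≤ Real.exp d * Real.exp (τ - d) := by gcongr
        _ = Real.exp τ := by rw [← Real.exp_add]; congr 1; ring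
    have h3 : Real.exp (-τ) ≤ Real.exp (-(τ - d)) := Real.exp_le_exp.2 (by linarith)
    rw [Real.sinh_eq, Real.sinh_eq]
    linarith [Real.exp_pos (-(τ - d))]
  have h2 : Real.sinh d ≤ Real.exp d / 2 := by
    rw [Real.sinh_eq]; linarith [Real.exp_pos (-d)]
  have h3 : Real.exp τ / 4 ≤ Real.sinh τ := by
    have h4 : Real.exp (-τ) ≤ 1 := Real.exp_le_one_iff.2 (by linarith)
    have h5 := Real.add_one_le_exp τ
    rw [Real.sinh_eq]; linarith
  -- After absorption, `a ≤ 4 b sinh d / sinh τ`, and `sinh d ≤ e^d/2`, `sinh τ ≥ e^τ/4` give the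
  -- constant 8, whose square is 64.
  have h4 : a ≤ 8 * b * Real.exp (d - τ) := by
    rw [← mul_div_assoc] at key
    have h5 : a * Real.sinh τ ≤ 2 * (a * Real.sinh (τ - d) + b * Real.sinh d) :=
      (le_div_iff₀ hs).1 (hle'.trans key)
    have h6 : a * Real.sinh (τ - d) ≤ a * (1 / 4 * Real.sinh τ) := by gcongr
    have h7 : b * Real.sinh d ≤ b * (Real.exp d / 2) := by gcongr
    have h8 : a * (Real.exp τ / 4) ≤ a * Real.sinh τ := by gcongr
    have h9 : a * Real.exp τ ≤ 8 * b * Real.exp d := by linarith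
    rw [Real.exp_sub, ← mul_div_assoc, le_div_iff₀ (Real.exp_pos τ)]
    exact h9
  have h5 : S α = a ^ 2 := (Real.sq_sqrt hα0).symm
  have h6 : S β = b ^ 2 := (Real.sq_sqrt hβ0).symm
  have h7 : Real.exp (2 * d) * Real.exp (-2 * τ) = Real.exp (d - τ) ^ 2 := by
    rw [← Real.exp_add, ← Real.exp_nat_mul]; congr 1; push_cast; ring
  rw [h5, h6, mul_assoc (64 : ℝ), h7]
  calc a ^ 2 ≤ (8 * b * Real.exp (d - τ)) ^ 2 := by gcongr
    _ = _ := by ring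

/-! ### Integrals depending on a parameter, and integral inequalities -/

theorem continuous_slice {F : Type*} [TopologicalSpace F] {A : Set ℝ} {G : ℝ × ℝ → F} (hG : ContinuousOn G (A ×ˢ univ)) {t : ℝ}
    (ht : t ∈ A) : Continuous fun θ => G (t, θ) :=
  hG.comp_continuous (by fun_prop) fun _ => ⟨ht, mem_univ _⟩

section Parametric

variable {F : Type*} [NormedAddCommGroup F] [NormedSpace ℝ F]

theorem continuousOn_intervalIntegral_slice {A : Set ℝ} {G : ℝ × ℝ → F}
    (hG : ContinuousOn G (A ×ˢ univ)) (a b : ℝ) :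
    ContinuousOn (fun t => ∫ θ in a..b, G (t, θ)) A := by
  rw [continuousOn_iff_continuous_domRestrict]
  refine intervalIntegral.continuous_parametric_intervalIntegral_of_continuous'
    (f := fun (x : A) θ => G (x, θ)) (hG.comp_continuous (by fun_prop) fun x => ?_) a b
  exact ⟨x.1.2, mem_univ _⟩

theorem hasDerivAt_intervalIntegral_slice {A : Set ℝ} (hA : IsOpen A) {G G₁ : ℝ × ℝ → F}
    (hG : ContinuousOn G (A ×ˢ univ)) (hG₁ : ContinuousOn G₁ (A ×ˢ univ))
    (hd : ∀ t ∈ A, ∀ θ, HasDerivAt (fun s => G (s, θ)) (G₁ (t, θ)) t) (a b : ℝ) {t : ℝ}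
    (ht : t ∈ A) :
    HasDerivAt (fun s => ∫ θ in a..b, G (s, θ)) (∫ θ in a..b, G₁ (t, θ)) t := by
  obtain ⟨δ, hδ, hball⟩ := Metric.nhds_basis_closedBall.mem_iff.1 (hA.mem_nhds ht)
  obtain ⟨M, hM⟩ := ((isCompact_closedBall t δ).prod (isCompact_uIcc (a := a) (b := b))).exists_bound_of_continuousOn
    (hG₁.mono (prod_mono hball (subset_univ _)))
  refine (intervalIntegral.hasDerivAt_integral_of_dominated_loc_of_deriv_le
    (F := fun s θ => G (s, θ)) (F' := fun s θ => G₁ (s, θ)) (bound := fun _ => M)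
    (Metric.closedBall_mem_nhds t hδ) ?_ ?_ ?_ ?_ ?_ ?_).2
  · filter_upwards [hA.mem_nhds ht] with s hs
    exact (continuous_slice hG hs).aestronglyMeasurable
  · exact (continuous_slice hG ht).intervalIntegrable _ _
  · exact (continuous_slice hG₁ ht).aestronglyMeasurable
  · exact ae_of_all _ fun θ hθ s hs => hM (s, θ) ⟨hs, uIoc_subset_uIcc hθ⟩
  · exact intervalIntegrable_const
  · exact ae_of_all _ fun θ _ s hs => hd s (hball hs) θ

end Parametric

/-! ### Cauchy–Schwarz and Wirtinger inequalities -/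

theorem sq_intervalIntegral_inner_le {V : Type*} [NormedAddCommGroup V] [InnerProductSpace ℝ V]
    {v w : ℝ → V} (hv : Continuous v) (hw : Continuous w) {a b : ℝ} (hab : a ≤ b) :
    (∫ x in a..b, inner ℝ (v x) (w x)) ^ 2 ≤
      (∫ x in a..b, ‖v x‖ ^ 2) * ∫ x in a..b, ‖w x‖ ^ 2 := by
  have key : ∀ c : ℝ, 0 ≤ (∫ x in a..b, ‖v x‖ ^ 2) * (c * c) +
      2 * (∫ x in a..b, inner ℝ (v x) (w x)) * c + ∫ x in a..b, ‖w x‖ ^ 2 := fun c => by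
    have h1 : 0 ≤ ∫ x in a..b, ‖c • v x + w x‖ ^ 2 :=
      intervalIntegral.integral_nonneg hab fun x _ => by positivity
    have h2 : ∀ x, ‖c • v x + w x‖ ^ 2 =
        (c * c) * ‖v x‖ ^ 2 + 2 * c * inner ℝ (v x) (w x) + ‖w x‖ ^ 2 := fun x => by
      rw [norm_add_sq_real, norm_smul, real_inner_smul_left, mul_pow, Real.norm_eq_abs, sq_abs]
      ring
    simp_rw [h2] at h1
    rw [intervalIntegral.integral_add, intervalIntegral.integral_add,
      intervalIntegral.integral_const_mul, intervalIntegral.integral_const_mul] at h1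
    · linarith
    all_goals exact Continuous.intervalIntegrable (by fun_prop) _ _
  have := discrim_le_zero key
  rw [discrim] at this
  linarith

/-- By Parseval it suffices to compare Fourier coefficients: the zeroth vanishes with the mean, and
differentiation multiplies the `n`-th by `i n`, of modulus at least 1 for `n ≠ 0`. -/
theorem wirtinger_complex {f f' : ℝ → ℂ} (hf : ∀ x, HasDerivAt f (f' x) x) (hf' : Continuous f')
    (hper : f (2 * Real.pi) = f 0) (hmean : ∫ x in (0 : ℝ)..(2 * Real.pi), f x = 0) :
    ∫ x in (0 : ℝ)..(2 * Real.pi), ‖f x‖ ^ 2 ≤ ∫ x in (0 : ℝ)..(2 * Real.pi), ‖f' x‖ ^ 2 := by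
  have hπ : (0 : ℝ) < 2 * Real.pi := Real.two_pi_pos
  have hmem : ∀ g : ℝ → ℂ, Continuous g →
      MemLp g 2 (volume.restrict (Ioc 0 (2 * Real.pi))) := fun g hg => by
    obtain ⟨M, hM⟩ := (isCompact_Icc (a := (0 : ℝ)) (b := 2 * Real.pi)).exists_bound_of_continuousOn
      hg.continuousOn
    refine MemLp.of_bound hg.aestronglyMeasurable M ?_
    rw [ae_restrict_iff' measurableSet_Ioc]
    exact ae_of_all _ fun x hx => hM x (Ioc_subset_Icc_self hx)
  have hfc : Continuous f := continuous_iff_continuousAt.2 fun x => (hf x).continuousAt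
  have h1 := hasSum_sq_fourierCoeffOn hπ (hmem f hfc)
  have h2 := hasSum_sq_fourierCoeffOn hπ (hmem f' hf')
  have hle : ∀ n : ℤ, ‖fourierCoeffOn hπ f n‖ ^ 2 ≤ ‖fourierCoeffOn hπ f' n‖ ^ 2 := fun n => by
    rcases eq_or_ne n 0 with rfl | hn
    · have : fourierCoeffOn hπ f 0 = 0 := by
        rw [fourierCoeffOn_eq_integral]
        simp [hmean]
      rw [this]
      simp
    · rw [fourierCoeffOn_of_hasDerivAt hπ hn (fun x _ => hf x) (hf'.intervalIntegrable _ _), hper]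
      have hn1 : (1 : ℝ) ≤ |(n : ℝ)| := by exact_mod_cast Int.one_le_abs hn
      have hpos := Real.pi_pos
      gcongr
      rw [sub_self, mul_zero, zero_sub, norm_mul, norm_neg, norm_mul]
      have h3 : ‖(1 : ℂ) / (-2 * Real.pi * Complex.I * n)‖ = 1 / (2 * Real.pi * |(n : ℝ)|) := by
        simp [abs_of_pos hpos]
      have h4 : ‖((2 * Real.pi : ℝ) : ℂ) - ((0 : ℝ) : ℂ)‖ = 2 * Real.pi := by
        simp [abs_of_pos hpos]
      rw [h3, h4]
      rw [← mul_assoc]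
      refine mul_le_of_le_one_left (norm_nonneg _) ?_
      rw [one_div_mul_eq_div, div_le_one (by positivity)]
      exact le_mul_of_one_le_right hπ.le hn1
  have h3 := hasSum_le hle h1 h2
  rw [smul_eq_mul, smul_eq_mul] at h3
  exact le_of_mul_le_mul_left h3 (by simpa using Real.pi_pos)

/-- **Wirtinger's inequality** on the circle. -/
theorem wirtinger {p : ℕ} {v v' : ℝ → E p} (hv : ∀ x, HasDerivAt v (v' x) x)
    (hv' : Continuous v') (hper : v (2 * Real.pi) = v 0)
    (hmean : ∫ x in (0 : ℝ)..(2 * Real.pi), v x = 0) :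
    ∫ x in (0 : ℝ)..(2 * Real.pi), ‖v x‖ ^ 2 ≤ ∫ x in (0 : ℝ)..(2 * Real.pi), ‖v' x‖ ^ 2 := by
  have hvc : Continuous v := continuous_iff_continuousAt.2 fun x => (hv x).continuousAt
  have hsum : ∀ g : ℝ → E p, Continuous g → ∫ x in (0 : ℝ)..(2 * Real.pi), ‖g x‖ ^ 2 =
      ∑ i, ∫ x in (0 : ℝ)..(2 * Real.pi), ‖((g x i : ℝ) : ℂ)‖ ^ 2 := fun g hg => by
    rw [← intervalIntegral.integral_finsetSum]
    · simp_rw [EuclideanSpace.norm_sq_eq, Complex.norm_real]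
    · intro i _
      exact Continuous.intervalIntegrable (by fun_prop) _ _
  rw [hsum v hvc, hsum v' hv']
  refine Finset.sum_le_sum fun i _ => ?_
  refine wirtinger_complex (fun x => ?_) (by fun_prop) (by rw [hper]) ?_
  · have h1 : HasDerivAt (fun x => v x i) (v' x i) x :=
      (EuclideanSpace.proj (𝕜 := ℝ) i).hasFDerivAt.comp_hasDerivAt x (hv x)
    exact h1.ofReal_comp
  · have h1 := (EuclideanSpace.proj (𝕜 := ℝ) i).intervalIntegral_comp_comm
      (hvc.intervalIntegrable (μ := volume) 0 (2 * Real.pi))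
    rw [hmean, map_zero] at h1
    rw [intervalIntegral.integral_ofReal]
    exact_mod_cast h1

/-! ### Partial derivatives on a strip -/

section Partial

variable {F : Type*} [NormedAddCommGroup F] [NormedSpace ℝ F]

/-- The partial derivative in the first variable. -/
noncomputable def pd1 (G : ℝ × ℝ → F) (z : ℝ × ℝ) : F := fderiv ℝ G z (1, 0)

/-- The partial derivative in the second variable. -/
noncomputable def pd2 (G : ℝ × ℝ → F) (z : ℝ × ℝ) : F := fderiv ℝ G z (0, 1)

/-- The Laplacian on the plane. -/
noncomputable def lap (G : ℝ × ℝ → F) (z : ℝ × ℝ) : F := pd1 (pd1 G) z + pd2 (pd2 G) z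

variable {D : Set (ℝ × ℝ)} {G H : ℝ × ℝ → F} {z : ℝ × ℝ}

theorem differentiableAt_of_smoothOn (hD : IsOpen D) (hG : ContDiffOn ℝ ∞ G D) (hz : z ∈ D) :
    DifferentiableAt ℝ G z :=
  (hG.contDiffAt (hD.mem_nhds hz)).differentiableAt (by simp)

theorem contDiffOn_pd1 (hD : IsOpen D) (hG : ContDiffOn ℝ ∞ G D) : ContDiffOn ℝ ∞ (pd1 G) D :=
  (hG.fderiv_of_isOpen hD (by simp)).clm_apply contDiffOn_const

theorem contDiffOn_pd2 (hD : IsOpen D) (hG : ContDiffOn ℝ ∞ G D) : ContDiffOn ℝ ∞ (pd2 G) D :=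
  (hG.fderiv_of_isOpen hD (by simp)).clm_apply contDiffOn_const

theorem contDiffOn_lap (hD : IsOpen D) (hG : ContDiffOn ℝ ∞ G D) : ContDiffOn ℝ ∞ (lap G) D :=
  (contDiffOn_pd1 hD (contDiffOn_pd1 hD hG)).add (contDiffOn_pd2 hD (contDiffOn_pd2 hD hG))

theorem hasDerivAt_pd1 (hD : IsOpen D) (hG : ContDiffOn ℝ ∞ G D) {t θ : ℝ} (hz : (t, θ) ∈ D) :
    HasDerivAt (fun s => G (s, θ)) (pd1 G (t, θ)) t :=
  (differentiableAt_of_smoothOn hD hG hz).hasFDerivAt.comp_hasDerivAt t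
    ((hasDerivAt_id t).prodMk (hasDerivAt_const t θ))

theorem hasDerivAt_pd2 (hD : IsOpen D) (hG : ContDiffOn ℝ ∞ G D) {t θ : ℝ} (hz : (t, θ) ∈ D) :
    HasDerivAt (fun s => G (t, s)) (pd2 G (t, θ)) θ :=
  (differentiableAt_of_smoothOn hD hG hz).hasFDerivAt.comp_hasDerivAt θ
    ((hasDerivAt_const θ t).prodMk (hasDerivAt_id θ))

theorem fderiv_fderiv_apply (hD : IsOpen D) (hG : ContDiffOn ℝ ∞ G D) (hz : z ∈ D)
    (v w : ℝ × ℝ) :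
    fderiv ℝ (fun y => fderiv ℝ G y v) z w = fderiv ℝ (fderiv ℝ G) z w v := by
  have hd : DifferentiableAt ℝ (fderiv ℝ G) z :=
    ((hG.fderiv_of_isOpen hD (m := ∞) (by simp)).contDiffAt (hD.mem_nhds hz)).differentiableAt
      (by simp)
  rw [fderiv_clm_apply hd (differentiableAt_const v)]
  simp

theorem pd1_pd2_eq (hD : IsOpen D) (hG : ContDiffOn ℝ ∞ G D) (hz : z ∈ D) :
    pd1 (pd2 G) z = pd2 (pd1 G) z := by
  have hsymm : IsSymmSndFDerivAt ℝ G z :=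
    (hG.contDiffAt (hD.mem_nhds hz)).isSymmSndFDerivAt (by
      rw [minSmoothness_of_isRCLikeNormedField]
      exact ENat.LEInfty.out)
  simp only [pd1, pd2]
  erw [fderiv_fderiv_apply hD hG hz, fderiv_fderiv_apply hD hG hz]
  exact hsymm.eq _ _

theorem pd1_congr (hD : IsOpen D) (h : EqOn G H D) : EqOn (pd1 G) (pd1 H) D := fun z hz => by
  rw [pd1, pd1, (h.eventuallyEq_of_mem (hD.mem_nhds hz)).fderiv_eq]

theorem pd2_congr (hD : IsOpen D) (h : EqOn G H D) : EqOn (pd2 G) (pd2 H) D := fun z hz => by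
  rw [pd2, pd2, (h.eventuallyEq_of_mem (hD.mem_nhds hz)).fderiv_eq]

theorem pd1_add (hD : IsOpen D) (hG : ContDiffOn ℝ ∞ G D) (hH : ContDiffOn ℝ ∞ H D) (hz : z ∈ D) :
    pd1 (fun y => G y + H y) z = pd1 G z + pd1 H z := by
  simp only [pd1]
  rw [fderiv_fun_add (differentiableAt_of_smoothOn hD hG hz)
    (differentiableAt_of_smoothOn hD hH hz)]
  rfl

theorem pd2_add (hD : IsOpen D) (hG : ContDiffOn ℝ ∞ G D) (hH : ContDiffOn ℝ ∞ H D) (hz : z ∈ D) :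
    pd2 (fun y => G y + H y) z = pd2 G z + pd2 H z := by
  simp only [pd2]
  rw [fderiv_fun_add (differentiableAt_of_smoothOn hD hG hz)
    (differentiableAt_of_smoothOn hD hH hz)]
  rfl

theorem pd1_lap (hD : IsOpen D) (hG : ContDiffOn ℝ ∞ G D) (hz : z ∈ D) :
    pd1 (lap G) z = lap (pd1 G) z := by
  have h1 := contDiffOn_pd1 hD hG
  have h2 := contDiffOn_pd2 hD hG
  have h3 : pd1 (lap G) z = pd1 (pd1 (pd1 G)) z + pd1 (pd2 (pd2 G)) z :=
    pd1_add hD (contDiffOn_pd1 hD h1) (contDiffOn_pd2 hD h2) hz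
  rw [h3, pd1_pd2_eq hD h2 hz, pd2_congr hD (fun y hy => pd1_pd2_eq hD hG hy) hz]
  rfl

theorem pd2_lap (hD : IsOpen D) (hG : ContDiffOn ℝ ∞ G D) (hz : z ∈ D) :
    pd2 (lap G) z = lap (pd2 G) z := by
  have h1 := contDiffOn_pd1 hD hG
  have h2 := contDiffOn_pd2 hD hG
  have h3 : pd2 (lap G) z = pd2 (pd1 (pd1 G)) z + pd2 (pd2 (pd2 G)) z :=
    pd2_add hD (contDiffOn_pd1 hD h1) (contDiffOn_pd2 hD h2) hz
  rw [h3, ← pd1_pd2_eq hD h1 hz, ← pd1_congr hD (fun y hy => pd1_pd2_eq hD hG hy) hz]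
  rfl

theorem fderiv_shift {A : Set ℝ} (hA : IsOpen A) {c : ℝ}
    (h : ∀ t ∈ A, ∀ θ, G (t, θ + c) = G (t, θ)) {t : ℝ} (ht : t ∈ A) (θ : ℝ) :
    fderiv ℝ G (t, θ + c) = fderiv ℝ G (t, θ) := by
  have h1 : (fun y : ℝ × ℝ => G (y + (0, c))) =ᶠ[𝓝 (t, θ)] G := by
    filter_upwards [(hA.prod isOpen_univ).mem_nhds (⟨ht, mem_univ θ⟩ : (t, θ) ∈ A ×ˢ univ)]
      with y hy
    have := h y.1 hy.1 y.2
    simpa [Prod.add_def] using this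
  have h2 := h1.fderiv_eq (𝕜 := ℝ)
  rw [fderiv_comp_add_right] at h2
  simpa using h2

end Partial

section Inner

variable {V : Type*} [NormedAddCommGroup V] [InnerProductSpace ℝ V]
  {D : Set (ℝ × ℝ)} {v w : ℝ × ℝ → V} {z : ℝ × ℝ}

theorem pd1_inner (hD : IsOpen D) (hv : ContDiffOn ℝ ∞ v D) (hw : ContDiffOn ℝ ∞ w D)
    (hz : z ∈ D) :
    pd1 (fun y => inner ℝ (v y) (w y)) z = inner ℝ (v z) (pd1 w z) + inner ℝ (pd1 v z) (w z) :=
  fderiv_inner_apply ℝ (differentiableAt_of_smoothOn hD hv hz)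
    (differentiableAt_of_smoothOn hD hw hz) _

theorem pd2_inner (hD : IsOpen D) (hv : ContDiffOn ℝ ∞ v D) (hw : ContDiffOn ℝ ∞ w D)
    (hz : z ∈ D) :
    pd2 (fun y => inner ℝ (v y) (w y)) z = inner ℝ (v z) (pd2 w z) + inner ℝ (pd2 v z) (w z) :=
  fderiv_inner_apply ℝ (differentiableAt_of_smoothOn hD hv hz)
    (differentiableAt_of_smoothOn hD hw hz) _

theorem lap_norm_sq (hD : IsOpen D) (hv : ContDiffOn ℝ ∞ v D) (hz : z ∈ D) :
    lap (fun y => ‖v y‖ ^ 2) z =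
      2 * (inner ℝ (v z) (lap v z) + ‖pd1 v z‖ ^ 2 + ‖pd2 v z‖ ^ 2) := by
  have h1 := contDiffOn_pd1 hD hv
  have h2 := contDiffOn_pd2 hD hv
  have e0 : (fun y => ‖v y‖ ^ 2) = fun y => inner ℝ (v y) (v y) := by
    ext y; rw [real_inner_self_eq_norm_sq]
  have e1 : pd1 (pd1 fun y => ‖v y‖ ^ 2) z =
      2 * (inner ℝ (v z) (pd1 (pd1 v) z) + ‖pd1 v z‖ ^ 2) := by
    have e : EqOn (pd1 fun y => ‖v y‖ ^ 2)
        (fun y => inner ℝ (v y) (pd1 v y) + inner ℝ (v y) (pd1 v y)) D := fun y hy => by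
      rw [e0, pd1_inner hD hv hv hy, real_inner_comm (v y) (pd1 v y)]
    rw [pd1_congr hD e hz, pd1_add hD (hv.inner ℝ h1) (hv.inner ℝ h1) hz,
      pd1_inner hD hv h1 hz, real_inner_self_eq_norm_sq]
    ring
  have e2 : pd2 (pd2 fun y => ‖v y‖ ^ 2) z =
      2 * (inner ℝ (v z) (pd2 (pd2 v) z) + ‖pd2 v z‖ ^ 2) := by
    have e : EqOn (pd2 fun y => ‖v y‖ ^ 2)
        (fun y => inner ℝ (v y) (pd2 v y) + inner ℝ (v y) (pd2 v y)) D := fun y hy => by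
      rw [e0, pd2_inner hD hv hv hy, real_inner_comm (v y) (pd2 v y)]
    rw [pd2_congr hD e hz, pd2_add hD (hv.inner ℝ h2) (hv.inner ℝ h2) hz,
      pd2_inner hD hv h2 hz, real_inner_self_eq_norm_sq]
    ring
  rw [lap, e1, e2, lap, inner_add_right]
  ring

end Inner

/-! ### Maps with quadratically small normal Laplacian -/

/-- The energy density. -/
noncomputable def density {p : ℕ} (U : ℝ × ℝ → E p) (z : ℝ × ℝ) : ℝ := ‖pd1 U z‖ ^ 2 + ‖pd2 U z‖ ^ 2

/-- The analytic properties of a harmonic map with vanishing Pohozaev integrals on the open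
cylinder `A × S¹`. -/
structure IsHarmonicLike {p : ℕ} (A : Set ℝ) (C : ℝ) (U : ℝ × ℝ → E p) : Prop where
  isOpen : IsOpen A
  nonneg : 0 ≤ C
  smooth : ContDiffOn ℝ ∞ U (A ×ˢ univ)
  periodic : ∀ t ∈ A, ∀ θ, U (t, θ + 2 * Real.pi) = U (t, θ)
  norm_lap_le : ∀ z ∈ A ×ˢ univ, ‖lap U z‖ ≤ C * density U z
  inner_pd1 : ∀ z ∈ A ×ˢ univ, inner ℝ (pd1 U z) (lap U z) = 0
  inner_pd2 : ∀ z ∈ A ×ˢ univ, inner ℝ (pd2 U z) (lap U z) = 0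
  pohozaev : ∀ t ∈ A, ∫ θ in (0 : ℝ)..(2 * Real.pi), ‖pd1 U (t, θ)‖ ^ 2 =
    ∫ θ in (0 : ℝ)..(2 * Real.pi), ‖pd2 U (t, θ)‖ ^ 2

namespace IsHarmonicLike

variable {p : ℕ} {A : Set ℝ} {C : ℝ} {U : ℝ × ℝ → E p}

theorem isOpen_strip (hU : IsHarmonicLike A C U) : IsOpen (A ×ˢ (univ : Set ℝ)) :=
  hU.isOpen.prod isOpen_univ

theorem contDiffOn_density (hU : IsHarmonicLike A C U) :
    ContDiffOn ℝ ∞ (density U) (A ×ˢ univ) :=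
  ((contDiffOn_pd1 hU.isOpen_strip hU.smooth).norm_sq ℝ).add
    ((contDiffOn_pd2 hU.isOpen_strip hU.smooth).norm_sq ℝ)

theorem density_nonneg (U : ℝ × ℝ → E p) (z : ℝ × ℝ) : 0 ≤ density U z := by
  rw [density]; positivity

theorem density_periodic (hU : IsHarmonicLike A C U) {t : ℝ} (ht : t ∈ A) (θ : ℝ) :
    density U (t, θ + 2 * Real.pi) = density U (t, θ) := by
  simp only [density, pd1, pd2, fderiv_shift hU.isOpen hU.periodic ht]

/-- **Bochner's inequality** for the energy density. -/
theorem neg_le_lap_density (hU : IsHarmonicLike A C U) {z : ℝ × ℝ} (hz : z ∈ A ×ˢ univ) :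
    -(2 * C ^ 2 * density U z ^ 2) ≤ lap (density U) z := by
  have hD := hU.isOpen_strip
  have h1 := contDiffOn_pd1 hD hU.smooth
  have h2 := contDiffOn_pd2 hD hU.smooth
  have hL := contDiffOn_lap hD hU.smooth
  have hn1 : ContDiffOn ℝ ∞ (fun y => ‖pd1 U y‖ ^ 2) (A ×ˢ univ) := h1.norm_sq ℝ
  have hn2 : ContDiffOn ℝ ∞ (fun y => ‖pd2 U y‖ ^ 2) (A ×ˢ univ) := h2.norm_sq ℝ
  have hsplit : lap (density U) z =
      lap (fun y => ‖pd1 U y‖ ^ 2) z + lap (fun y => ‖pd2 U y‖ ^ 2) z := by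
    have e1 : EqOn (pd1 (density U))
        (fun y => pd1 (fun y => ‖pd1 U y‖ ^ 2) y + pd1 (fun y => ‖pd2 U y‖ ^ 2) y) (A ×ˢ univ) :=
      fun y hy => pd1_add hD hn1 hn2 hy
    have e2 : EqOn (pd2 (density U))
        (fun y => pd2 (fun y => ‖pd1 U y‖ ^ 2) y + pd2 (fun y => ‖pd2 U y‖ ^ 2) y) (A ×ˢ univ) :=
      fun y hy => pd2_add hD hn1 hn2 hy
    simp only [lap]
    rw [pd1_congr hD e1 hz, pd2_congr hD e2 hz,
      pd1_add hD (contDiffOn_pd1 hD hn1) (contDiffOn_pd1 hD hn2) hz,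
      pd2_add hD (contDiffOn_pd2 hD hn1) (contDiffOn_pd2 hD hn2) hz]
    ring
  -- Differentiating `⟪∂_t u, Δu⟫ = 0` in `t` removes the third derivatives from Bochner's formula;
  -- adding the analogue in `θ`, the two terms contribute exactly `-‖Δu‖²`.
  have o1 : inner ℝ (pd1 U z) (lap (pd1 U) z) + inner ℝ (pd1 (pd1 U) z) (lap U z) = 0 := by
    have e : EqOn (fun y => inner ℝ (pd1 U y) (lap U y)) (fun _ => (0 : ℝ)) (A ×ˢ univ) :=
      fun y hy => hU.inner_pd1 y hy
    have := pd1_congr hD e hz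
    rw [pd1_inner hD h1 hL hz, pd1_lap hD hU.smooth hz] at this
    rw [this]
    simp [pd1]
  have o2 : inner ℝ (pd2 U z) (lap (pd2 U) z) + inner ℝ (pd2 (pd2 U) z) (lap U z) = 0 := by
    have e : EqOn (fun y => inner ℝ (pd2 U y) (lap U y)) (fun _ => (0 : ℝ)) (A ×ˢ univ) :=
      fun y hy => hU.inner_pd2 y hy
    have := pd2_congr hD e hz
    rw [pd2_inner hD h2 hL hz, pd2_lap hD hU.smooth hz] at this
    rw [this]
    simp [pd2]
  have o3 : inner ℝ (pd1 (pd1 U) z) (lap U z) + inner ℝ (pd2 (pd2 U) z) (lap U z) =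
      ‖lap U z‖ ^ 2 := by
    rw [← inner_add_left, ← real_inner_self_eq_norm_sq]; rfl
  have h3 : ‖lap U z‖ ^ 2 ≤ C ^ 2 * density U z ^ 2 := by
    rw [← mul_pow]
    gcongr
    exact hU.norm_lap_le z hz
  rw [hsplit, lap_norm_sq hD h1 hz, lap_norm_sq hD h2 hz]
  nlinarith [sq_nonneg ‖pd1 (pd1 U) z‖, sq_nonneg ‖pd2 (pd1 U) z‖, sq_nonneg ‖pd1 (pd2 U) z‖,
    sq_nonneg ‖pd2 (pd2 U) z‖]

/-- With `f = ∫|∂_θu|²`, so that `S = 2f`, the second derivative contains `∫⟪∂_θu, ∂_t²∂_θu⟫ =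
∫|∂_θ²u|² - ∫⟪∂_θ²u, Δu⟫`. Wirtinger bounds the first term below by `f`, the quadratic bound on `Δu`
makes the second small, and Cauchy–Schwarz for `S'` absorbs `S'²` into the term with `|∂_t∂_θu|²`.
-/
theorem exists_deriv_energy (hU : IsHarmonicLike A C U) : ∃ S₁ S₂ : ℝ → ℝ, ∀ t ∈ A,
    HasDerivAt (fun t => ∫ θ in (0 : ℝ)..(2 * Real.pi), density U (t, θ)) (S₁ t) t ∧
    HasDerivAt S₁ (S₂ t) t ∧ ∀ s, 0 ≤ s → C * s ≤ 2 → (∀ θ, density U (t, θ) ≤ s ^ 2) →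
      4 * (1 - 3 / 2 * (C * s)) * (∫ θ in (0 : ℝ)..(2 * Real.pi), density U (t, θ)) ^ 2 ≤
        2 * (∫ θ in (0 : ℝ)..(2 * Real.pi), density U (t, θ)) * S₂ t - S₁ t ^ 2 := by
  have hD := hU.isOpen_strip
  have h1 := contDiffOn_pd1 hD hU.smooth
  have h2 := contDiffOn_pd2 hD hU.smooth
  have h11 := contDiffOn_pd1 hD h1
  have h12 := contDiffOn_pd1 hD h2
  have h22 := contDiffOn_pd2 hD h2
  have h112 := contDiffOn_pd1 hD h12
  have hcs : ∀ {G : ℝ × ℝ → E p}, ContDiffOn ℝ ∞ G (A ×ˢ univ) → ∀ {t}, t ∈ A →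
      Continuous fun θ => G (t, θ) := fun hG _ ht => continuous_slice hG.continuousOn ht
  have hS : ∀ t ∈ A, ∫ θ in (0 : ℝ)..(2 * Real.pi), density U (t, θ) =
      2 * ∫ θ in (0 : ℝ)..(2 * Real.pi), ‖pd2 U (t, θ)‖ ^ 2 := fun t ht => by
    simp only [density]
    have c1 := hcs h1 ht
    have c2 := hcs h2 ht
    rw [intervalIntegral.integral_add (Continuous.intervalIntegrable (by fun_prop) _ _)
      (Continuous.intervalIntegrable (by fun_prop) _ _), hU.pohozaev t ht]
    ring
  refine ⟨fun t => ∫ θ in (0 : ℝ)..(2 * Real.pi), 4 * inner ℝ (pd2 U (t, θ)) (pd1 (pd2 U) (t, θ)),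
    fun t => ∫ θ in (0 : ℝ)..(2 * Real.pi), 4 * (inner ℝ (pd2 U (t, θ)) (pd1 (pd1 (pd2 U)) (t, θ)) +
      inner ℝ (pd1 (pd2 U) (t, θ)) (pd1 (pd2 U) (t, θ))), fun t ht => ⟨?_, ?_, ?_⟩⟩
  · have key := hasDerivAt_intervalIntegral_slice hU.isOpen
      (G := fun z => 2 * ‖pd2 U z‖ ^ 2) (G₁ := fun z => 4 * inner ℝ (pd2 U z) (pd1 (pd2 U) z))
      (contDiffOn_const.mul (h2.norm_sq ℝ)).continuousOn
      (contDiffOn_const.mul (h2.inner ℝ h12)).continuousOn (fun t ht θ => by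
        exact ((hasDerivAt_pd1 hD h2 ⟨ht, mem_univ θ⟩).norm_sq.const_mul 2).congr_deriv (by ring))
      0 (2 * Real.pi) ht
    refine key.congr_of_eventuallyEq ?_
    filter_upwards [hU.isOpen.mem_nhds ht] with s hs
    rw [hS s hs, intervalIntegral.integral_const_mul]
  · exact hasDerivAt_intervalIntegral_slice hU.isOpen
      (G := fun z => 4 * inner ℝ (pd2 U z) (pd1 (pd2 U) z))
      (G₁ := fun z => 4 * (inner ℝ (pd2 U z) (pd1 (pd1 (pd2 U)) z) +
        inner ℝ (pd1 (pd2 U) z) (pd1 (pd2 U) z)))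
      (contDiffOn_const.mul (h2.inner ℝ h12)).continuousOn
      (contDiffOn_const.mul ((h2.inner ℝ h112).add (h12.inner ℝ h12))).continuousOn
      (fun t ht θ => ((hasDerivAt_pd1 hD h2 ⟨ht, mem_univ θ⟩).inner ℝ
        (hasDerivAt_pd1 hD h12 ⟨ht, mem_univ θ⟩)).const_mul 4) 0 (2 * Real.pi) ht
  · intro s hs0 hCs hs
    have hz : ∀ θ, (t, θ) ∈ A ×ˢ (univ : Set ℝ) := fun θ => ⟨ht, mem_univ θ⟩
    have c2 := hcs h2 ht
    have c12 := hcs h12 ht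
    have c22 := hcs h22 ht
    have c11 := hcs h11 ht
    have c112 := hcs h112 ht
    have cL := hcs (contDiffOn_lap hD hU.smooth) ht
    have ce := continuous_slice hU.contDiffOn_density.continuousOn ht
    have hper2 : pd2 U (t, 2 * Real.pi) = pd2 U (t, 0) := by
      have := fderiv_shift hU.isOpen hU.periodic ht 0
      rw [zero_add] at this
      rw [pd2, pd2, this]
    have hper11 : pd1 (pd1 U) (t, 2 * Real.pi) = pd1 (pd1 U) (t, 0) := by
      have := fderiv_shift (G := pd1 U) hU.isOpen (fun t ht θ => by
        rw [pd1, pd1, fderiv_shift hU.isOpen hU.periodic ht]) ht 0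
      rw [zero_add] at this
      rw [pd1, pd1, this]
    have hmean : ∫ θ in (0 : ℝ)..(2 * Real.pi), pd2 U (t, θ) = 0 := by
      rw [intervalIntegral.integral_eq_sub_of_hasDerivAt
        (fun θ _ => hasDerivAt_pd2 hD hU.smooth (hz θ)) (c2.intervalIntegrable _ _)]
      have := hU.periodic t ht 0
      rw [zero_add] at this
      rw [this, sub_self]
    have hW := wirtinger (fun θ => hasDerivAt_pd2 hD h2 (hz θ)) c22 hper2 hmean
    have hCS := sq_intervalIntegral_inner_le c2 c12 Real.two_pi_pos.le
    -- integration by parts on the circle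
    have hparts : ∫ θ in (0 : ℝ)..(2 * Real.pi), (inner ℝ (pd2 U (t, θ)) (pd1 (pd1 (pd2 U)) (t, θ)) +
        inner ℝ (pd2 (pd2 U) (t, θ)) (pd1 (pd1 U) (t, θ))) = 0 := by
      have hd : ∀ θ, HasDerivAt (fun θ => inner ℝ (pd2 U (t, θ)) (pd1 (pd1 U) (t, θ)))
          (inner ℝ (pd2 U (t, θ)) (pd1 (pd1 (pd2 U)) (t, θ)) +
            inner ℝ (pd2 (pd2 U) (t, θ)) (pd1 (pd1 U) (t, θ))) θ := fun θ => by
        have e : pd1 (pd1 (pd2 U)) (t, θ) = pd2 (pd1 (pd1 U)) (t, θ) := by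
          rw [← pd1_pd2_eq hD h1 (hz θ)]
          exact pd1_congr hD (fun y hy => pd1_pd2_eq hD hU.smooth hy) (hz θ)
        rw [e]
        exact (hasDerivAt_pd2 hD h2 (hz θ)).inner ℝ (hasDerivAt_pd2 hD h11 (hz θ))
      rw [intervalIntegral.integral_eq_sub_of_hasDerivAt (fun θ _ => hd θ)
        (Continuous.intervalIntegrable (by fun_prop) _ _), hper2, hper11, sub_self]
    -- One factor `|∇u| ≤ s` is split off from `C|∇u|²` and the remaining product is symmetrised by
    -- `2xy ≤ x² + y²`.
    have hpt : ∀ θ, inner ℝ (pd2 (pd2 U) (t, θ)) (lap U (t, θ)) ≤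
        C * s / 2 * (‖pd2 (pd2 U) (t, θ)‖ ^ 2 + density U (t, θ)) := fun θ => by
      have he := density_nonneg U (t, θ)
      have hr : √(density U (t, θ)) ≤ s := Real.sqrt_le_iff.2 ⟨hs0, hs θ⟩
      have hrr := Real.sq_sqrt he
      calc inner ℝ (pd2 (pd2 U) (t, θ)) (lap U (t, θ))
          ≤ ‖pd2 (pd2 U) (t, θ)‖ * ‖lap U (t, θ)‖ := real_inner_le_norm _ _
        _ ≤ ‖pd2 (pd2 U) (t, θ)‖ * (C * density U (t, θ)) := by
          gcongr; exact hU.norm_lap_le _ (hz θ)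
        _ = C * √(density U (t, θ)) * (‖pd2 (pd2 U) (t, θ)‖ * √(density U (t, θ))) := by
          nth_rewrite 1 [← hrr]; ring
        _ ≤ C * s * (‖pd2 (pd2 U) (t, θ)‖ * √(density U (t, θ))) := by
          have := hU.nonneg
          gcongr
        _ ≤ C * s * ((‖pd2 (pd2 U) (t, θ)‖ ^ 2 + √(density U (t, θ)) ^ 2) / 2) := by
          have := hU.nonneg
          gcongr
          nlinarith [sq_nonneg (‖pd2 (pd2 U) (t, θ)‖ - √(density U (t, θ)))]
        _ = _ := by rw [hrr]; ring
    have hint : ∫ θ in (0 : ℝ)..(2 * Real.pi), inner ℝ (pd2 (pd2 U) (t, θ)) (lap U (t, θ)) ≤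
        C * s / 2 * ((∫ θ in (0 : ℝ)..(2 * Real.pi), ‖pd2 (pd2 U) (t, θ)‖ ^ 2) +
          ∫ θ in (0 : ℝ)..(2 * Real.pi), density U (t, θ)) := by
      rw [← intervalIntegral.integral_add (Continuous.intervalIntegrable (by fun_prop) _ _)
        (ce.intervalIntegrable _ _), ← intervalIntegral.integral_const_mul]
      exact intervalIntegral.integral_mono Real.two_pi_pos.le
        (Continuous.intervalIntegrable (by fun_prop) _ _)
        (Continuous.intervalIntegrable (by fun_prop) _ _) hpt
    have hlap : ∫ θ in (0 : ℝ)..(2 * Real.pi), inner ℝ (pd2 (pd2 U) (t, θ)) (lap U (t, θ)) =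
        (∫ θ in (0 : ℝ)..(2 * Real.pi), inner ℝ (pd2 (pd2 U) (t, θ)) (pd1 (pd1 U) (t, θ))) +
        ∫ θ in (0 : ℝ)..(2 * Real.pi), ‖pd2 (pd2 U) (t, θ)‖ ^ 2 := by
      rw [← intervalIntegral.integral_add (Continuous.intervalIntegrable (by fun_prop) _ _)
        (Continuous.intervalIntegrable (by fun_prop) _ _)]
      simp only [lap, inner_add_right, real_inner_self_eq_norm_sq]
    rw [intervalIntegral.integral_add (Continuous.intervalIntegrable (by fun_prop) _ _)
        (Continuous.intervalIntegrable (by fun_prop) _ _)] at hparts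
    beta_reduce
    rw [intervalIntegral.integral_const_mul, intervalIntegral.integral_const_mul,
      intervalIntegral.integral_add (Continuous.intervalIntegrable (by fun_prop) _ _)
        (Continuous.intervalIntegrable (by fun_prop) _ _)]
    simp_rw [real_inner_self_eq_norm_sq]
    have hf0 : 0 ≤ ∫ θ in (0 : ℝ)..(2 * Real.pi), ‖pd2 U (t, θ)‖ ^ 2 :=
      intervalIntegral.integral_nonneg Real.two_pi_pos.le fun _ _ => by positivity
    rw [hS t ht] at hint ⊢
    set f := ∫ θ in (0 : ℝ)..(2 * Real.pi), ‖pd2 U (t, θ)‖ ^ 2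
    set Y := ∫ θ in (0 : ℝ)..(2 * Real.pi), ‖pd2 (pd2 U) (t, θ)‖ ^ 2
    set Z := ∫ θ in (0 : ℝ)..(2 * Real.pi), ‖pd1 (pd2 U) (t, θ)‖ ^ 2
    set J := ∫ θ in (0 : ℝ)..(2 * Real.pi), inner ℝ (pd2 U (t, θ)) (pd1 (pd2 U) (t, θ))
    set K := ∫ θ in (0 : ℝ)..(2 * Real.pi), inner ℝ (pd2 U (t, θ)) (pd1 (pd1 (pd2 U)) (t, θ))
    set M := ∫ θ in (0 : ℝ)..(2 * Real.pi), inner ℝ (pd2 (pd2 U) (t, θ)) (pd1 (pd1 U) (t, θ))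
    have hK : Y - C * s / 2 * (Y + 2 * f) ≤ K := by linarith
    -- The condition `C s ≤ 2` keeps the coefficient of Wirtinger's inequality nonnegative.
    have hY : (1 - C * s / 2) * f ≤ (1 - C * s / 2) * Y := by
      gcongr; linarith
    have hK' : (1 - 3 / 2 * (C * s)) * f ≤ K := by linarith
    have := mul_le_mul_of_nonneg_left hK' hf0
    linarith

end IsHarmonicLike

/-! ### The mean value inequality on discs -/

/-- Polar coordinates centred at `z`. -/
noncomputable def polarMap (z q : ℝ × ℝ) : ℝ × ℝ :=
  (z.1 + q.1 * Real.cos q.2, z.2 + q.1 * Real.sin q.2)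

theorem continuous_polarMap (z : ℝ × ℝ) : Continuous (polarMap z) := by
  unfold polarMap; fun_prop

theorem dist_polarMap_le (z q : ℝ × ℝ) : dist (polarMap z q) z ≤ |q.1| := by
  rw [Prod.dist_eq, polarMap, Real.dist_eq, Real.dist_eq]
  simp only [add_sub_cancel_left, abs_mul]
  refine max_le ?_ ?_
  · exact mul_le_of_le_one_right (abs_nonneg _) (Real.abs_cos_le_one _)
  · exact mul_le_of_le_one_right (abs_nonneg _) (Real.abs_sin_le_one _)

section MeanValue

variable {D : Set (ℝ × ℝ)} {g : ℝ × ℝ → ℝ} {z : ℝ × ℝ}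

theorem fderiv_apply_eq (g : ℝ × ℝ → ℝ) (y : ℝ × ℝ) (a b : ℝ) :
    fderiv ℝ g y (a, b) = a * pd1 g y + b * pd2 g y := by
  have : ((a, b) : ℝ × ℝ) = a • ((1, 0) : ℝ × ℝ) + b • ((0, 1) : ℝ × ℝ) := by simp
  rw [this, map_add, map_smul, map_smul, smul_eq_mul, smul_eq_mul, pd1, pd2]

theorem hasDerivAt_comp_polarMap_radius (hD : IsOpen D) (hg : ContDiffOn ℝ ∞ g D) {r θ : ℝ}
    (hr : polarMap z (r, θ) ∈ D) :
    HasDerivAt (fun s => g (polarMap z (s, θ)))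
      (Real.cos θ * pd1 g (polarMap z (r, θ)) + Real.sin θ * pd2 g (polarMap z (r, θ))) r := by
  rw [← fderiv_apply_eq]
  have h1 : HasDerivAt (fun s => polarMap z (s, θ)) (Real.cos θ, Real.sin θ) r :=
    (((hasDerivAt_id' r).mul_const (Real.cos θ)).const_add z.1 |>.congr_deriv (one_mul _)).prodMk
      (((hasDerivAt_id' r).mul_const (Real.sin θ)).const_add z.2 |>.congr_deriv (one_mul _))
  exact (differentiableAt_of_smoothOn hD hg hr).hasFDerivAt.comp_hasDerivAt r h1

theorem hasDerivAt_comp_polarMap_angle (hD : IsOpen D) (hg : ContDiffOn ℝ ∞ g D) {r θ : ℝ}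
    (hr : polarMap z (r, θ) ∈ D) :
    HasDerivAt (fun s => g (polarMap z (r, s)))
      (r * -Real.sin θ * pd1 g (polarMap z (r, θ)) + r * Real.cos θ * pd2 g (polarMap z (r, θ)))
      θ := by
  rw [← fderiv_apply_eq]
  have h1 : HasDerivAt (fun s => polarMap z (r, s)) (r * -Real.sin θ, r * Real.cos θ) θ :=
    (((Real.hasDerivAt_cos θ).const_mul r).const_add z.1).prodMk
      (((Real.hasDerivAt_sin θ).const_mul r).const_add z.2)
  exact (differentiableAt_of_smoothOn hD hg hr).hasFDerivAt.comp_hasDerivAt θ h1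

/-- A function whose Laplacian is at least `-K` lies below its circle averages up to `K r² / 4`. -/
theorem le_circle_integral (hD : IsOpen D) (hg : ContDiffOn ℝ ∞ g D) {σ ρ K : ℝ}
    (hball : Metric.ball z σ ⊆ D) (hρσ : ρ < σ)
    (hlap : ∀ y ∈ Metric.closedBall z ρ, -K ≤ lap g y) {r : ℝ} (hr : r ∈ Icc 0 ρ) :
    2 * Real.pi * g z ≤ (∫ θ in (-Real.pi)..Real.pi, g (polarMap z (r, θ))) +
      Real.pi * K / 2 * r ^ 2 := by
  -- Negative radii are allowed so that `r = 0` is an interior point and the radial derivatives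
  -- there are two-sided.
  let A : Set ℝ := Ioo (-σ) σ
  have hA : IsOpen A := isOpen_Ioo
  have hmaps : MapsTo (polarMap z) (A ×ˢ univ) D := fun q hq =>
    hball ((dist_polarMap_le z q).trans_lt (abs_lt.2 hq.1))
  have hmem : ∀ {s}, s ∈ A → ∀ θ, polarMap z (s, θ) ∈ D := fun hs θ => hmaps ⟨hs, mem_univ θ⟩
  have hρA : ∀ s ∈ Icc 0 ρ, s ∈ A := fun s hs =>
    ⟨by linarith [hs.1, hs.2], hs.2.trans_lt hρσ⟩
  have hcomp : ∀ {f : ℝ × ℝ → ℝ}, ContDiffOn ℝ ∞ f D →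
      ContinuousOn (fun q => f (polarMap z q)) (A ×ˢ univ) := fun hf =>
    hf.continuousOn.comp (continuous_polarMap z).continuousOn hmaps
  have g1 := contDiffOn_pd1 hD hg
  have g2 := contDiffOn_pd2 hD hg
  have g11 := contDiffOn_pd1 hD g1
  have g21 := contDiffOn_pd2 hD g1
  have g12 := contDiffOn_pd1 hD g2
  have g22 := contDiffOn_pd2 hD g2
  have c := hcomp hg
  have c1 := hcomp g1
  have c2 := hcomp g2
  have c11 := hcomp g11
  have c21 := hcomp g21
  have c12 := hcomp g12
  have c22 := hcomp g22
  have cL := hcomp (contDiffOn_lap hD hg)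
  have ccos : ContinuousOn (fun q : ℝ × ℝ => Real.cos q.2) (A ×ˢ univ) := by fun_prop
  have csin : ContinuousOn (fun q : ℝ × ℝ => Real.sin q.2) (A ×ˢ univ) := by fun_prop
  let G₁ : ℝ × ℝ → ℝ := fun q =>
    Real.cos q.2 * pd1 g (polarMap z q) + Real.sin q.2 * pd2 g (polarMap z q)
  let G₂ : ℝ × ℝ → ℝ := fun q =>
    Real.cos q.2 * (Real.cos q.2 * pd1 (pd1 g) (polarMap z q) +
      Real.sin q.2 * pd2 (pd1 g) (polarMap z q)) +
    Real.sin q.2 * (Real.cos q.2 * pd1 (pd2 g) (polarMap z q) +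
      Real.sin q.2 * pd2 (pd2 g) (polarMap z q))
  have cG₁ : ContinuousOn G₁ (A ×ˢ univ) := (ccos.mul c1).add (csin.mul c2)
  have cG₂ : ContinuousOn G₂ (A ×ˢ univ) :=
    (ccos.mul ((ccos.mul c11).add (csin.mul c21))).add (csin.mul ((ccos.mul c12).add (csin.mul c22)))
  have dΦ : ∀ {s}, s ∈ A → HasDerivAt
      (fun s => ∫ θ in (-Real.pi)..Real.pi, g (polarMap z (s, θ)))
      (∫ θ in (-Real.pi)..Real.pi, G₁ (s, θ)) s := fun hs =>
    hasDerivAt_intervalIntegral_slice hA (G := fun q => g (polarMap z q)) c cG₁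
      (fun s hs θ => hasDerivAt_comp_polarMap_radius hD hg (hmem hs θ)) _ _ hs
  have dP : ∀ {s}, s ∈ A → HasDerivAt (fun s => ∫ θ in (-Real.pi)..Real.pi, G₁ (s, θ))
      (∫ θ in (-Real.pi)..Real.pi, G₂ (s, θ)) s := fun hs =>
    hasDerivAt_intervalIntegral_slice hA cG₁ cG₂ (fun s hs θ =>
      ((hasDerivAt_comp_polarMap_radius hD g1 (hmem hs θ)).const_mul (Real.cos θ)).add
        ((hasDerivAt_comp_polarMap_radius hD g2 (hmem hs θ)).const_mul (Real.sin θ))) _ _ hs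
  -- the angular part integrates to zero
  have hang : ∀ s ∈ A, (∫ θ in (-Real.pi)..Real.pi, G₁ (s, θ)) +
      s * (∫ θ in (-Real.pi)..Real.pi, G₂ (s, θ)) =
      s * ∫ θ in (-Real.pi)..Real.pi, lap g (polarMap z (s, θ)) := fun s hs => by
    -- `H` is `r⁻¹ ∂_θ` of `g` in polar coordinates, written so that it makes sense at radius 0.
    let H : ℝ → ℝ := fun θ => -Real.sin θ * pd1 g (polarMap z (s, θ)) +
      Real.cos θ * pd2 g (polarMap z (s, θ))
    have dH : ∀ θ, HasDerivAt H (s * lap g (polarMap z (s, θ)) - (G₁ (s, θ) + s * G₂ (s, θ))) θ :=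
      fun θ => by
        have h := ((Real.hasDerivAt_sin θ).fun_neg.mul
          (hasDerivAt_comp_polarMap_angle hD g1 (hmem hs θ))).add
          ((Real.hasDerivAt_cos θ).mul (hasDerivAt_comp_polarMap_angle hD g2 (hmem hs θ)))
        refine h.congr_deriv ?_
        simp only [G₁, G₂, lap, pd1_pd2_eq hD hg (hmem hs θ)]
        linear_combination (s * pd1 (pd1 g) (polarMap z (s, θ)) +
          s * pd2 (pd2 g) (polarMap z (s, θ))) * Real.sin_sq_add_cos_sq θ
    have sG₁ := continuous_slice cG₁ hs
    have sG₂ := continuous_slice cG₂ hs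
    have sL := continuous_slice cL hs
    have sG₂' : Continuous fun θ => s * G₂ (s, θ) := continuous_const.mul sG₂
    have sL' : Continuous fun θ => s * lap g (polarMap z (s, θ)) := continuous_const.mul sL
    have sG : Continuous fun θ => G₁ (s, θ) + s * G₂ (s, θ) := sG₁.add sG₂'
    have hint := intervalIntegral.integral_eq_sub_of_hasDerivAt (a := -Real.pi) (b := Real.pi)
      (fun θ _ => dH θ) ((sL'.sub sG).intervalIntegrable _ _)
    have hH : H Real.pi - H (-Real.pi) = 0 := by simp [H, polarMap]
    rw [hH, intervalIntegral.integral_sub (sL'.intervalIntegrable _ _)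
      (sG.intervalIntegrable _ _),
      intervalIntegral.integral_add (sG₁.intervalIntegrable _ _) (sG₂'.intervalIntegrable _ _),
      intervalIntegral.integral_const_mul, intervalIntegral.integral_const_mul] at hint
    linarith
  have hπ := Real.pi_pos
  have hL : ∀ s ∈ Icc 0 ρ, -(2 * Real.pi * K) ≤
      ∫ θ in (-Real.pi)..Real.pi, lap g (polarMap z (s, θ)) := fun s hs => by
    have h1 : ∫ _ in (-Real.pi)..Real.pi, -K ≤
        ∫ θ in (-Real.pi)..Real.pi, lap g (polarMap z (s, θ)) :=
      intervalIntegral.integral_mono (by linarith) intervalIntegrable_const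
        ((continuous_slice cL (hρA s hs)).intervalIntegrable _ _) fun θ => hlap _ <|
          (dist_polarMap_le z (s, θ)).trans (abs_le.2 ⟨by linarith [hs.1, hs.2], hs.2⟩)
    rw [intervalIntegral.integral_const, smul_eq_mul] at h1
    linarith
  have dQ : ∀ {s}, s ∈ A → HasDerivAt
      (fun s => s * (∫ θ in (-Real.pi)..Real.pi, G₁ (s, θ)) + Real.pi * K * s ^ 2)
      (s * (∫ θ in (-Real.pi)..Real.pi, lap g (polarMap z (s, θ))) + 2 * Real.pi * K * s) s :=
    fun {s} hs => by
      refine (((hasDerivAt_id' s).mul (dP hs)).add ((hasDerivAt_pow 2 s).const_mul _)).congr_deriv ?_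
      rw [← hang s hs]
      simp
      ring
  -- With `Φ` the circle integral, `(rΦ')' = r∫Δg ≥ -2πKr`. Integrating from 0 gives `Φ' ≥ -πKr`,
  -- and once more the claim.
  have mQ : MonotoneOn
      (fun s => s * (∫ θ in (-Real.pi)..Real.pi, G₁ (s, θ)) + Real.pi * K * s ^ 2) (Icc 0 ρ) := by
    refine monotoneOn_of_deriv_nonneg (convex_Icc 0 ρ)
      (fun s hs => (dQ (hρA s hs)).continuousAt.continuousWithinAt)
      (fun s hs => (dQ (hρA s (interior_subset hs))).differentiableAt.differentiableWithinAt) ?_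
    intro s hs
    have hs' := interior_subset hs
    rw [(dQ (hρA s hs')).deriv]
    nlinarith [mul_le_mul_of_nonneg_left (hL s hs') hs'.1]
  have dR : ∀ {s}, s ∈ A → HasDerivAt
      (fun s => (∫ θ in (-Real.pi)..Real.pi, g (polarMap z (s, θ))) + Real.pi * K / 2 * s ^ 2)
      ((∫ θ in (-Real.pi)..Real.pi, G₁ (s, θ)) + Real.pi * K * s) s := fun {s} hs =>
    ((dΦ hs).add ((hasDerivAt_pow 2 s).const_mul _)).congr_deriv (by simp; ring)
  have mR : MonotoneOn
      (fun s => (∫ θ in (-Real.pi)..Real.pi, g (polarMap z (s, θ))) + Real.pi * K / 2 * s ^ 2)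
      (Icc 0 ρ) := by
    refine monotoneOn_of_deriv_nonneg (convex_Icc 0 ρ)
      (fun s hs => (dR (hρA s hs)).continuousAt.continuousWithinAt)
      (fun s hs => (dR (hρA s (interior_subset hs))).differentiableAt.differentiableWithinAt) ?_
    intro s hs
    have hs' := interior_subset hs
    rw [interior_Icc] at hs
    rw [(dR (hρA s hs')).deriv]
    have h1 := mQ (⟨le_rfl, hs'.1.trans hs'.2⟩ : (0 : ℝ) ∈ Icc 0 ρ) hs' hs'.1
    simp only [zero_mul, ne_eq, OfNat.ofNat_ne_zero, not_false_eq_true, zero_pow, mul_zero,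
      add_zero] at h1
    refine le_of_mul_le_mul_left ?_ hs.1
    linarith
  have h1 := mR (⟨le_rfl, hr.1.trans hr.2⟩ : (0 : ℝ) ∈ Icc 0 ρ) hr hr.1
  have h0 : ∀ θ, polarMap z (0, θ) = z := fun θ => by simp [polarMap]
  simp only [h0, intervalIntegral.integral_const, smul_eq_mul] at h1
  linarith

/-- As `ρ ≤ π`, the disc lies in a rectangle spanning one period in the angular variable, so no
point of the cylinder is counted twice. -/
theorem integral_polarMap_le {t θ ρ : ℝ} (hρ0 : 0 ≤ ρ) (hρ : ρ ≤ Real.pi)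
    (hg : ContinuousOn g (Icc (t - ρ) (t + ρ) ×ˢ univ))
    (hg0 : ∀ s ∈ Icc (t - ρ) (t + ρ), ∀ φ, 0 ≤ g (s, φ))
    (hper : ∀ s ∈ Icc (t - ρ) (t + ρ), ∀ φ, g (s, φ + 2 * Real.pi) = g (s, φ)) :
    ∫ r in (0 : ℝ)..ρ, r * ∫ φ in (-Real.pi)..Real.pi, g (polarMap (t, θ) (r, φ)) ≤
      ∫ s in (t - ρ)..(t + ρ), ∫ φ in (0 : ℝ)..(2 * Real.pi), g (s, φ) := by
  have hπ := Real.pi_pos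
  let B : Set (ℝ × ℝ) := {x | x.1 ^ 2 + x.2 ^ 2 ≤ ρ ^ 2}
  let R : Set (ℝ × ℝ) := Icc (-ρ) ρ ×ˢ Icc (-Real.pi) Real.pi
  have hB : MeasurableSet B := measurableSet_le (by fun_prop) (by fun_prop)
  have hBR : B ⊆ R := fun x hx => by
    have hx' : x.1 ^ 2 + x.2 ^ 2 ≤ ρ ^ 2 := hx
    have h1 : x.1 ^ 2 ≤ ρ ^ 2 := by linarith [sq_nonneg x.2]
    have h2 : x.2 ^ 2 ≤ ρ ^ 2 := by linarith [sq_nonneg x.1]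
    have h3 := abs_le.1 (abs_le_of_sq_le_sq h1 hρ0)
    have h4 := abs_le.1 (abs_le_of_sq_le_sq h2 hρ0)
    exact ⟨h3, by linarith [h4.1], by linarith [h4.2]⟩
  let f : ℝ × ℝ → ℝ := fun x => g (t + x.1, θ + x.2)
  have hmapsR : ∀ x : ℝ × ℝ, x.1 ∈ Icc (-ρ) ρ → t + x.1 ∈ Icc (t - ρ) (t + ρ) := fun x hx =>
    ⟨by linarith [hx.1], by linarith [hx.2]⟩
  have hfR : ContinuousOn f R := hg.comp (by fun_prop) fun x hx => ⟨hmapsR x hx.1, mem_univ _⟩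
  have hfi : IntegrableOn f R :=
    hfR.integrableOn_compact (isCompact_Icc.prod isCompact_Icc)
  have hstep1 : ∫ x in B, f x ≤ ∫ x in R, f x := by
    refine setIntegral_mono_set hfi ?_ hBR.eventuallyLE
    rw [Filter.EventuallyLE, ae_restrict_iff' (measurableSet_Icc.prod measurableSet_Icc)]
    exact ae_of_all _ fun x hx => hg0 _ (hmapsR x hx.1) _
  have hstep2 : ∫ x in R, f x =
      ∫ s in (t - ρ)..(t + ρ), ∫ φ in (0 : ℝ)..(2 * Real.pi), g (s, φ) := by
    have h1 : ∫ x in R, f x = ∫ s in (-ρ)..ρ, ∫ φ in (-Real.pi)..Real.pi, f (s, φ) := by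
      rw [Measure.volume_eq_prod, setIntegral_prod f hfi, integral_Icc_eq_integral_Ioc,
        intervalIntegral.integral_of_le (by linarith)]
      simp_rw [integral_Icc_eq_integral_Ioc,
        intervalIntegral.integral_of_le (by linarith : -Real.pi ≤ Real.pi)]
    have h2 : ∀ s ∈ Icc (t - ρ) (t + ρ), ∫ φ in (-Real.pi)..Real.pi, g (s, θ + φ) =
        ∫ φ in (0 : ℝ)..(2 * Real.pi), g (s, φ) := fun s hs => by
      rw [intervalIntegral.integral_comp_add_left (fun φ => g (s, φ))]
      have hp : Function.Periodic (fun φ => g (s, φ)) (2 * Real.pi) := hper s hs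
      have := hp.intervalIntegral_add_eq (θ + -Real.pi) 0
      rw [zero_add] at this
      rw [← this]
      congr 1
      ring
    rw [h1, show t - ρ = t + -ρ by ring,
      ← intervalIntegral.integral_comp_add_left
        (fun s => ∫ φ in (0 : ℝ)..(2 * Real.pi), g (s, φ))]
    refine intervalIntegral.integral_congr fun s hs => ?_
    rw [uIcc_of_le (by linarith)] at hs
    exact h2 (t + s) (hmapsR (s, 0) hs)
  have hstep3 : ∫ r in (0 : ℝ)..ρ, r * ∫ φ in (-Real.pi)..Real.pi, g (polarMap (t, θ) (r, φ)) =
      ∫ x in B, f x := by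
    rw [← integral_indicator hB, ← integral_comp_polarCoord_symm]
    have e1 : ∀ q ∈ polarCoord.target, q.1 • B.indicator f (polarCoord.symm q) =
        (Iic ρ ×ˢ (univ : Set ℝ)).indicator (fun q => q.1 * g (polarMap (t, θ) q)) q := by
      intro q hq
      have hq1 : 0 < q.1 := hq.1
      have hiff : polarCoord.symm q ∈ B ↔ q ∈ Iic ρ ×ˢ (univ : Set ℝ) := by
        have : (q.1 * Real.cos q.2) ^ 2 + (q.1 * Real.sin q.2) ^ 2 = q.1 ^ 2 := by
          linear_combination q.1 ^ 2 * Real.sin_sq_add_cos_sq q.2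
        simp only [B, polarCoord_symm_apply, mem_ofPred_eq, this, mem_prod, mem_Iic, mem_univ,
          and_true]
        exact pow_le_pow_iff_left₀ hq1.le hρ0 two_ne_zero
      by_cases h : polarCoord.symm q ∈ B
      · rw [indicator_of_mem h, indicator_of_mem (hiff.1 h)]
        simp [f, polarMap]
      · rw [indicator_of_notMem h, indicator_of_notMem (fun h' => h (hiff.2 h'))]
        simp
    rw [setIntegral_congr_fun polarCoord.open_target.measurableSet e1,
      setIntegral_indicator (measurableSet_Iic.prod MeasurableSet.univ)]
    have e2 : polarCoord.target ∩ Iic ρ ×ˢ (univ : Set ℝ) =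
        Ioc 0 ρ ×ˢ Ioo (-Real.pi) Real.pi := by
      ext q
      simp only [polarCoord_target, mem_inter_iff, mem_prod, mem_Ioi, mem_Iic, mem_univ, and_true,
        mem_Ioc]
      tauto
    have hmaps : ∀ q : ℝ × ℝ, q.1 ∈ Icc 0 ρ →
        polarMap (t, θ) q ∈ Icc (t - ρ) (t + ρ) ×ˢ (univ : Set ℝ) := fun q hq => by
      refine ⟨?_, mem_univ _⟩
      have h1 := (le_max_left _ _).trans (dist_polarMap_le (t, θ) q)
      rw [Real.dist_eq, abs_of_nonneg hq.1] at h1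
      have h2 := abs_le.1 (h1.trans hq.2)
      exact ⟨by linarith [h2.1], by linarith [h2.2]⟩
    have hint : IntegrableOn (fun q : ℝ × ℝ => q.1 * g (polarMap (t, θ) q))
        (Ioc 0 ρ ×ˢ Ioo (-Real.pi) Real.pi) := by
      have hc : ContinuousOn (fun q : ℝ × ℝ => q.1 * g (polarMap (t, θ) q))
          (Icc 0 ρ ×ˢ Icc (-Real.pi) Real.pi) :=
        continuousOn_fst.mul (hg.comp (continuous_polarMap _).continuousOn
          fun q hq => hmaps q hq.1)
      exact (hc.integrableOn_compact (isCompact_Icc.prod isCompact_Icc)).mono_set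
        (prod_mono Ioc_subset_Icc_self Ioo_subset_Icc_self)
    rw [e2, Measure.volume_eq_prod, setIntegral_prod _ hint, intervalIntegral.integral_of_le hρ0]
    simp_rw [integral_const_mul, ← integral_Ioc_eq_integral_Ioo,
      intervalIntegral.integral_of_le (by linarith : -Real.pi ≤ Real.pi)]
  rw [hstep3, ← hstep2]
  exact hstep1

/-- The circle inequality is multiplied by `r` and integrated over `[0, ρ]`. Balls are for the sup
metric, hence contain the Euclidean discs of the same radius. -/
theorem le_disc_integral (hD : IsOpen D) (hg : ContDiffOn ℝ ∞ g D) {t θ σ ρ K : ℝ}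
    (hball : Metric.ball (t, θ) σ ⊆ D) (hρ0 : 0 ≤ ρ) (hρσ : ρ < σ) (hρπ : ρ ≤ Real.pi)
    (hlap : ∀ y ∈ Metric.closedBall (t, θ) ρ, -K ≤ lap g y)
    (hstrip : Icc (t - ρ) (t + ρ) ×ˢ univ ⊆ D)
    (hg0 : ∀ s ∈ Icc (t - ρ) (t + ρ), ∀ φ, 0 ≤ g (s, φ))
    (hper : ∀ s ∈ Icc (t - ρ) (t + ρ), ∀ φ, g (s, φ + 2 * Real.pi) = g (s, φ)) :
    Real.pi * ρ ^ 2 * g (t, θ) ≤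
      (∫ s in (t - ρ)..(t + ρ), ∫ φ in (0 : ℝ)..(2 * Real.pi), g (s, φ)) +
        Real.pi * K / 8 * ρ ^ 4 := by
  have h1 := integral_polarMap_le (θ := θ) hρ0 hρπ (hg.continuousOn.mono hstrip) hg0 hper
  have hcont : ContinuousOn (fun r => ∫ φ in (-Real.pi)..Real.pi, g (polarMap (t, θ) (r, φ)))
      (Icc 0 ρ) := by
    refine continuousOn_intervalIntegral_slice (G := fun q => g (polarMap (t, θ) q)) ?_ _ _
    refine hg.continuousOn.comp (continuous_polarMap _).continuousOn fun q hq => hball ?_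
    refine (dist_polarMap_le _ q).trans_lt ?_
    rw [abs_of_nonneg hq.1.1]
    exact hq.1.2.trans_lt hρσ
  have h2 : ∫ r in (0 : ℝ)..ρ, (2 * Real.pi * g (t, θ) * r - Real.pi * K / 2 * r ^ 3) ≤
      ∫ r in (0 : ℝ)..ρ, r * ∫ φ in (-Real.pi)..Real.pi, g (polarMap (t, θ) (r, φ)) := by
    refine intervalIntegral.integral_mono_on hρ0
      (Continuous.intervalIntegrable (by fun_prop) _ _) ?_ fun r hr => ?_
    · refine ContinuousOn.intervalIntegrable ?_
      rw [uIcc_of_le hρ0]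
      exact continuousOn_id.mul hcont
    · have h3 := mul_le_mul_of_nonneg_left (le_circle_integral hD hg hball hρσ hlap hr) hr.1
      linarith
  rw [intervalIntegral.integral_sub (Continuous.intervalIntegrable (by fun_prop) _ _)
    (Continuous.intervalIntegrable (by fun_prop) _ _), intervalIntegral.integral_const_mul,
    intervalIntegral.integral_const_mul, integral_id, integral_pow] at h2
  norm_num at h2
  linarith

end MeanValue

/-! ### Interior estimates from small energy -/

/-- **ε-regularity**: small energy on a cylinder of length one bounds the energy density on the
middle circle. -/
theorem IsHarmonicLike.density_le {p : ℕ} {A : Set ℝ} {C : ℝ} {U : ℝ × ℝ → E p}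
    (hU : IsHarmonicLike A C U) (hC : 0 < C) {t : ℝ} (ht : Icc (t - 1 / 2) (t + 1 / 2) ⊆ A)
    (hsmall : 16 * C ^ 2 * (∫ s in (t - 1 / 2)..(t + 1 / 2),
      ∫ φ in (0 : ℝ)..(2 * Real.pi), density U (s, φ)) < Real.pi) (θ : ℝ) :
    density U (t, θ) ≤ 32 / Real.pi * ∫ s in (t - 1 / 2)..(t + 1 / 2),
      ∫ φ in (0 : ℝ)..(2 * Real.pi), density U (s, φ) := by
  have hπ := Real.pi_pos
  have hD := hU.isOpen_strip
  have hce := hU.contDiffOn_density.continuousOn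
  set η := ∫ s in (t - 1 / 2)..(t + 1 / 2), ∫ φ in (0 : ℝ)..(2 * Real.pi), density U (s, φ) with hη
  have hS0 : ∀ s, 0 ≤ ∫ φ in (0 : ℝ)..(2 * Real.pi), density U (s, φ) := fun s =>
    intervalIntegral.integral_nonneg Real.two_pi_pos.le fun φ _ => density_nonneg U _
  have hη0 : 0 ≤ η := intervalIntegral.integral_nonneg (by linarith) fun s _ => hS0 s
  let x₀ : ℝ × ℝ := (t, θ)
  have hsub : Metric.closedBall x₀ (1 / 2) ⊆ A ×ˢ (univ : Set ℝ) := fun x hx => by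
    have h1 := (le_max_left _ _).trans (Metric.mem_closedBall.1 hx)
    rw [Real.dist_eq] at h1
    have h2 := abs_le.1 h1
    exact ⟨ht ⟨by linarith [h2.1], by linarith [h2.2]⟩, mem_univ _⟩
  -- Point picking: the density weighted by the squared distance to the boundary is maximised. On
  -- the ball about `x₁` of radius `σ`, half the distance from `x₁` to the boundary, the density is
  -- then at most `4 e₁`.
  obtain ⟨x₁, hx₁, hmax⟩ := (isCompact_closedBall x₀ (1 / 2)).exists_isMaxOn
    ⟨x₀, Metric.mem_closedBall_self (by norm_num)⟩
    (f := fun x => (1 / 2 - dist x x₀) ^ 2 * density U x)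
    (((continuousOn_const.sub (by fun_prop)).pow 2).mul (hce.mono hsub))
  have hmax' : ∀ x ∈ Metric.closedBall x₀ (1 / 2), (1 / 2 - dist x x₀) ^ 2 * density U x ≤
      (1 / 2 - dist x₁ x₀) ^ 2 * density U x₁ := fun x hx => hmax hx
  have hcentre := hmax' x₀ (Metric.mem_closedBall_self (by norm_num))
  rw [dist_self, sub_zero] at hcentre
  have hd0 : 0 ≤ 1 / 2 - dist x₁ x₀ := by linarith [Metric.mem_closedBall.1 hx₁]
  have hE0 := density_nonneg U x₁
  obtain ⟨σ, hσ⟩ : ∃ σ, σ = (1 / 2 - dist x₁ x₀) / 2 := ⟨_, rfl⟩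
  have hσ0 : 0 ≤ σ := by rw [hσ]; linarith
  have hdσ : 1 / 2 - dist x₁ x₀ = 2 * σ := by rw [hσ]; ring
  rw [hdσ] at hcentre
  set e₁ := density U x₁
  have hgoal : 16 * (σ ^ 2 * e₁) ≤ 32 / Real.pi * η → density U (t, θ) ≤ 32 / Real.pi * η := by
    intro h
    have : density U x₀ = density U (t, θ) := rfl
    linarith
  have hηπ : 0 ≤ 32 / Real.pi * η := by positivity
  rcases hE0.eq_or_lt with hE | hE
  · exact hgoal (by rw [← hE]; simpa using hηπ)
  rcases hσ0.eq_or_lt with hs | hs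
  · exact hgoal (by rw [← hs]; simpa using hηπ)
  -- the mean value inequality on discs around the maximum point
  have key : ∀ ρ, 0 ≤ ρ → ρ ≤ σ →
      Real.pi * (ρ ^ 2 * e₁) ≤ η + 4 * Real.pi * C ^ 2 * (ρ ^ 2 * e₁) ^ 2 := by
    intro ρ hρ0 hρ
    have hσ12 : σ ≤ 1 / 4 := by rw [hσ]; linarith [dist_nonneg (x := x₁) (y := x₀)]
    have hx1 : |x₁.1 - t| ≤ 1 / 2 - 2 * σ := by
      have h1 : dist x₁.1 t ≤ dist x₁ x₀ := le_max_left _ _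
      rw [Real.dist_eq] at h1
      linarith
    have hx1' := abs_le.1 hx1
    have hIcc : Icc (x₁.1 - ρ) (x₁.1 + ρ) ⊆ Icc (t - 1 / 2) (t + 1 / 2) :=
      Icc_subset_Icc (by linarith) (by linarith)
    have hball : Metric.ball (x₁.1, x₁.2) (2 * σ) ⊆ A ×ˢ (univ : Set ℝ) := fun x hx => by
      refine hsub (Metric.mem_closedBall.2 ?_)
      have h1 := Metric.mem_ball.1 hx
      rw [Prod.mk.eta] at h1
      linarith [dist_triangle x x₁ x₀]
    -- Bochner's constant `2C²` times `(4e₁)²` gives `K`.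
    have h := le_disc_integral (K := 32 * C ^ 2 * e₁ ^ 2) hD hU.contDiffOn_density hball hρ0
      (by linarith) (by linarith [Real.pi_gt_three]) ?_ ?_ ?_ ?_
    · rw [Prod.mk.eta] at h
      have hmono : ∫ s in (x₁.1 - ρ)..(x₁.1 + ρ), ∫ φ in (0 : ℝ)..(2 * Real.pi), density U (s, φ) ≤
          η := by
        refine intervalIntegral.integral_mono_interval (by linarith) (by linarith) (by linarith)
          (ae_of_all _ fun s => hS0 s) ?_
        refine ContinuousOn.intervalIntegrable ?_
        rw [uIcc_of_le (by linarith)]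
        exact continuousOn_intervalIntegral_slice (hce.mono (prod_mono ht subset_rfl)) _ _
      calc Real.pi * (ρ ^ 2 * e₁) = Real.pi * ρ ^ 2 * e₁ := by ring
        _ ≤ _ := h
        _ ≤ η + Real.pi * (32 * C ^ 2 * e₁ ^ 2) / 8 * ρ ^ 4 := by gcongr
        _ = _ := by ring
    · intro y hy
      rw [Prod.mk.eta] at hy
      have hy1 := Metric.mem_closedBall.1 hy
      have hy2 : dist y x₀ ≤ 1 / 2 - σ := by linarith [dist_triangle y x₁ x₀]
      have hyK : y ∈ Metric.closedBall x₀ (1 / 2) := Metric.mem_closedBall.2 (by linarith)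
      have h1 := hmax' y hyK
      rw [hdσ] at h1
      have h2 : σ ^ 2 * density U y ≤ (1 / 2 - dist y x₀) ^ 2 * density U y := by
        have := density_nonneg U y
        gcongr
        linarith
      have h3 : density U y ≤ 4 * e₁ := by
        refine le_of_mul_le_mul_left ?_ (pow_pos hs 2)
        linarith
      have h4 := hU.neg_le_lap_density (hsub hyK)
      have h5 : density U y ^ 2 ≤ (4 * e₁) ^ 2 :=
        pow_le_pow_left₀ (density_nonneg U y) h3 2
      nlinarith [mul_le_mul_of_nonneg_left h5 (sq_nonneg C)]
    · exact prod_mono (hIcc.trans ht) subset_rfl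
    · exact fun s _ φ => density_nonneg U _
    · exact fun s hs φ => hU.density_periodic (ht (hIcc hs)) φ
  have hY0 : 0 ≤ σ ^ 2 * e₁ := by positivity
  -- With `Y = ρ²e₁`, the estimate reads `πY ≤ η + 4πC²Y²`. If `Y` could reach `1/(8C²)`, this value
  -- would force `16C²η ≥ π`, contrary to the smallness of the energy. Below it the quadratic term
  -- is at most `πY/2` and is absorbed.
  rcases le_or_gt (1 / (8 * C ^ 2)) (σ ^ 2 * e₁) with hlarge | hlt
  · exfalso
    have hρsq : √(1 / (8 * C ^ 2) / e₁) ^ 2 * e₁ = 1 / (8 * C ^ 2) := by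
      rw [Real.sq_sqrt (by positivity)]
      field_simp
    have h := key (√(1 / (8 * C ^ 2) / e₁)) (Real.sqrt_nonneg _)
      (Real.sqrt_le_iff.2 ⟨hσ0, by rw [div_le_iff₀ hE]; exact hlarge⟩)
    rw [hρsq] at h
    have h2 := mul_le_mul_of_nonneg_left h (by positivity : 0 ≤ 16 * C ^ 2)
    have h3 : 16 * C ^ 2 * (Real.pi * (1 / (8 * C ^ 2))) = 2 * Real.pi := by
      field_simp; norm_num
    have h4 : 16 * C ^ 2 * (η + 4 * Real.pi * C ^ 2 * (1 / (8 * C ^ 2)) ^ 2) =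
        16 * C ^ 2 * η + Real.pi := by
      field_simp; ring
    linarith
  · have h := key σ hσ0 le_rfl
    have h1 : 8 * C ^ 2 * (σ ^ 2 * e₁) ≤ 1 := by
      rw [lt_div_iff₀ (by positivity)] at hlt
      linarith
    have h2 : 4 * Real.pi * C ^ 2 * (σ ^ 2 * e₁) ^ 2 ≤ Real.pi / 2 * (σ ^ 2 * e₁) := by
      have := mul_le_mul_of_nonneg_right h1 (mul_nonneg hπ.le hY0)
      linarith
    refine hgoal ?_
    rw [div_mul_eq_mul_div, le_div_iff₀ hπ]
    linarith

/-! ### Harmonic maps on cylinders -/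

section Bridge

variable {p : ℕ} {T : ℝ} {u v : ℝ → ℝ → E p} {G : ℝ × ℝ → E p}

/-- The map on the plane underlying a map on the cylinder. -/
def planeMap (u : ℝ → ℝ → E p) (z : ℝ × ℝ) : E p := u z.1 z.2

theorem isOpen_Ioo_strip (T : ℝ) : IsOpen (Ioo 0 T ×ˢ (univ : Set ℝ)) :=
  isOpen_Ioo.prod isOpen_univ

theorem dt_eq_pd1 (hG : ContDiffOn ℝ ∞ G (Ioo 0 T ×ˢ univ))
    (hv : ∀ t ∈ Ioo 0 T, ∀ θ, v t θ = G (t, θ)) {t : ℝ} (ht : t ∈ Ioo 0 T) (θ : ℝ) :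
    dt T v t θ = pd1 G (t, θ) := by
  have h1 : (fun s => v s θ) =ᶠ[𝓝 t] fun s => G (s, θ) := by
    filter_upwards [isOpen_Ioo.mem_nhds ht] with s hs
    exact hv s hs θ
  rw [dt, derivWithin_of_mem_nhds (Icc_mem_nhds ht.1 ht.2), h1.deriv_eq]
  exact (hasDerivAt_pd1 (isOpen_Ioo_strip T) hG ⟨ht, mem_univ θ⟩).deriv

theorem dθ_eq_pd2 (hG : ContDiffOn ℝ ∞ G (Ioo 0 T ×ˢ univ))
    (hv : ∀ t ∈ Ioo 0 T, ∀ θ, v t θ = G (t, θ)) {t : ℝ} (ht : t ∈ Ioo 0 T) (θ : ℝ) :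
    dθ v t θ = pd2 G (t, θ) := by
  have h1 : v t = fun s => G (t, s) := funext fun s => hv t ht s
  rw [dθ, h1]
  exact (hasDerivAt_pd2 (isOpen_Ioo_strip T) hG ⟨ht, mem_univ θ⟩).deriv

theorem sliceEnergy_nonneg (T : ℝ) (u : ℝ → ℝ → E p) (t : ℝ) : 0 ≤ sliceEnergy T u t :=
  intervalIntegral.integral_nonneg Real.two_pi_pos.le fun θ _ => by rw [gradSq]; positivity

/-- Continuity up to the end circles, where the interior description through `pd1` is unavailable;
derivatives within the closed strip are used instead. -/
theorem continuousOn_gradSq (hT : 0 < T)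
    (hu : ContDiffOn ℝ ∞ (fun z : ℝ × ℝ => u z.1 z.2) (Icc 0 T ×ˢ univ)) :
    ContinuousOn (fun z : ℝ × ℝ => gradSq T u z.1 z.2) (Icc 0 T ×ˢ univ) := by
  have hK : UniqueDiffOn ℝ (Icc 0 T ×ˢ (univ : Set ℝ)) := (uniqueDiffOn_Icc hT).prod uniqueDiffOn_univ
  have hc := hu.continuousOn_fderivWithin hK (by simp)
  have hd : ∀ z ∈ Icc 0 T ×ˢ (univ : Set ℝ), HasFDerivWithinAt (fun z : ℝ × ℝ => u z.1 z.2)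
      (fderivWithin ℝ (fun z : ℝ × ℝ => u z.1 z.2) (Icc 0 T ×ˢ univ) z) (Icc 0 T ×ˢ univ) z :=
    fun z hz => ((hu z hz).differentiableWithinAt (by simp)).hasFDerivWithinAt
  have e1 : ∀ z ∈ Icc 0 T ×ˢ (univ : Set ℝ), dt T u z.1 z.2 =
      fderivWithin ℝ (fun z : ℝ × ℝ => u z.1 z.2) (Icc 0 T ×ˢ univ) z (1, 0) := fun z hz => by
    have h := (hd z hz).comp_hasDerivWithinAt (s := Icc 0 T) z.1
      (((hasDerivAt_id z.1).prodMk (hasDerivAt_const z.1 z.2)).hasDerivWithinAt)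
      (t := Icc 0 T ×ˢ univ) fun s hs => ⟨hs, mem_univ _⟩
    exact h.derivWithin (uniqueDiffOn_Icc hT z.1 hz.1)
  have e2 : ∀ z ∈ Icc 0 T ×ˢ (univ : Set ℝ), dθ u z.1 z.2 =
      fderivWithin ℝ (fun z : ℝ × ℝ => u z.1 z.2) (Icc 0 T ×ˢ univ) z (0, 1) := fun z hz => by
    have h := (hd z hz).comp_hasDerivWithinAt (s := univ) z.2
      (((hasDerivAt_const z.2 z.1).prodMk (hasDerivAt_id z.2)).hasDerivWithinAt)
      (t := Icc 0 T ×ˢ univ) fun s _ => ⟨hz.1, mem_univ _⟩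
    exact (hasDerivWithinAt_univ.1 h).deriv
  have h3 : ContinuousOn (fun z : ℝ × ℝ =>
      ‖fderivWithin ℝ (fun z : ℝ × ℝ => u z.1 z.2) (Icc 0 T ×ˢ univ) z (1, 0)‖ ^ 2 +
      ‖fderivWithin ℝ (fun z : ℝ × ℝ => u z.1 z.2) (Icc 0 T ×ˢ univ) z (0, 1)‖ ^ 2)
      (Icc 0 T ×ˢ univ) :=
    ((hc.clm_apply continuousOn_const).norm.pow 2).add
      ((hc.clm_apply continuousOn_const).norm.pow 2)
  refine h3.congr fun z hz => ?_
  rw [gradSq, e1 z hz, e2 z hz]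

theorem continuousOn_sliceEnergy (hT : 0 < T)
    (hu : ContDiffOn ℝ ∞ (fun z : ℝ × ℝ => u z.1 z.2) (Icc 0 T ×ˢ univ)) :
    ContinuousOn (sliceEnergy T u) (Icc 0 T) :=
  continuousOn_intervalIntegral_slice (continuousOn_gradSq hT hu) 0 (2 * Real.pi)

end Bridge

namespace IsHarmonicMap

variable {p : ℕ} {N : Set (E p)} {T C : ℝ} {u : ℝ → ℝ → E p}

theorem contDiffOn_planeMap (hu : IsHarmonicMap N T u) :
    ContDiffOn ℝ ∞ (planeMap u) (Ioo 0 T ×ˢ univ) :=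
  hu.smooth.mono (prod_mono Ioo_subset_Icc_self subset_rfl)

theorem dt_eq (hu : IsHarmonicMap N T u) : ∀ t ∈ Ioo 0 T, ∀ θ,
    dt T u t θ = pd1 (planeMap u) (t, θ) := fun _ ht θ =>
  dt_eq_pd1 hu.contDiffOn_planeMap (fun _ _ _ => rfl) ht θ

theorem dθ_eq (hu : IsHarmonicMap N T u) : ∀ t ∈ Ioo 0 T, ∀ θ,
    dθ u t θ = pd2 (planeMap u) (t, θ) := fun _ ht θ =>
  dθ_eq_pd2 hu.contDiffOn_planeMap (fun _ _ _ => rfl) ht θ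

theorem gradSq_eq (hu : IsHarmonicMap N T u) {t : ℝ} (ht : t ∈ Ioo 0 T) (θ : ℝ) :
    gradSq T u t θ = density (planeMap u) (t, θ) := by
  rw [gradSq, density, hu.dt_eq t ht, hu.dθ_eq t ht]

theorem sliceEnergy_eq (hu : IsHarmonicMap N T u) {t : ℝ} (ht : t ∈ Ioo 0 T) :
    sliceEnergy T u t = ∫ θ in (0 : ℝ)..(2 * Real.pi), density (planeMap u) (t, θ) := by
  simp only [sliceEnergy, hu.gradSq_eq ht]

/-- The curvature bound is applied to the two coordinate curves through a point: their accelerations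
add up to `Δu`, and their velocities are tangent, hence orthogonal to it. -/
theorem isHarmonicLike (hu : IsHarmonicMap N T u) (hC : 0 ≤ C) (hN : HasCurvatureBound N N C)
    (hP : PohozaevZero T u) : IsHarmonicLike (Ioo 0 T) C (planeMap u) := by
  have hD := isOpen_Ioo_strip T
  have hs := hu.contDiffOn_planeMap
  have h1 := contDiffOn_pd1 hD hs
  have h2 := contDiffOn_pd2 hD hs
  have hI : ∀ {t}, t ∈ Ioo 0 T → t ∈ Icc 0 T := fun ht => Ioo_subset_Icc_self ht
  have hadd : ∀ a : ℝ, Tendsto (fun s : ℝ => a + s) (𝓝 0) (𝓝 a) := fun a =>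
    (continuous_const.add continuous_id : Continuous fun s : ℝ => a + s).tendsto' 0 a (add_zero a)
  have hev : ∀ {t}, t ∈ Ioo 0 T → ∀ᶠ s in 𝓝 (0 : ℝ), t + s ∈ Ioo 0 T := fun {t} ht =>
    (hadd t).eventually_mem (isOpen_Ioo.mem_nhds ht)
  -- the two coordinate curves through a point
  have hα : ∀ {t}, t ∈ Ioo 0 T → ∀ θ, ∀ᶠ s in 𝓝 (0 : ℝ),
      HasDerivAt (fun s => u (t + s) θ) (pd1 (planeMap u) (t + s, θ)) s := fun {t} ht θ => by
    filter_upwards [hev ht] with s hs'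
    exact (hasDerivAt_pd1 hD hs (⟨hs', mem_univ θ⟩ : (t + s, θ) ∈ Ioo 0 T ×ˢ univ)).comp_const_add t s
  have hβ : ∀ {t}, t ∈ Ioo 0 T → ∀ θ s,
      HasDerivAt (fun s => u t (θ + s)) (pd2 (planeMap u) (t, θ + s)) s := fun {t} ht θ s =>
    (hasDerivAt_pd2 hD hs (⟨ht, mem_univ _⟩ : (t, θ + s) ∈ Ioo 0 T ×ˢ univ)).comp_const_add θ s
  have hαN : ∀ {t}, t ∈ Ioo 0 T → ∀ θ, ∀ᶠ s in 𝓝 (0 : ℝ), u (t + s) θ ∈ N := fun {t} ht θ => by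
    filter_upwards [hev ht] with s hs'
    exact hu.mem _ (hI hs') θ
  have hten : ∀ {t}, t ∈ Ioo 0 T → ∀ θ, ∀ v ∈ tangentVectors N (u t θ),
      inner ℝ (lap (planeMap u) (t, θ)) v = 0 := fun {t} ht θ v hv => by
    have := hu.tension t (hI ht) θ v hv
    rwa [dt_eq_pd1 h1 hu.dt_eq ht, dθ_eq_pd2 h2 hu.dθ_eq ht] at this
  refine ⟨isOpen_Ioo, hC, hs, fun t ht θ => hu.periodic t (hI ht) θ, ?_, ?_, ?_, ?_⟩
  · rintro ⟨t, θ⟩ ⟨ht, -⟩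
    have e1 : HasDerivAt (fun s => pd1 (planeMap u) (t + s, θ)) (pd1 (pd1 (planeMap u)) (t, θ)) 0 := by
      have := hasDerivAt_pd1 hD h1 (⟨by simpa using ht, mem_univ θ⟩ : (t + 0, θ) ∈ Ioo 0 T ×ˢ univ)
      simpa using this.comp_const_add t 0
    have e2 : HasDerivAt (fun s => pd2 (planeMap u) (t, θ + s)) (pd2 (pd2 (planeMap u)) (t, θ)) 0 := by
      have := hasDerivAt_pd2 hD h2 (⟨ht, mem_univ _⟩ : (t, θ + 0) ∈ Ioo 0 T ×ˢ univ)
      simpa using this.comp_const_add θ 0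
    have := hN (fun s => u (t + s) θ) (fun s => pd1 (planeMap u) (t + s, θ))
      (fun s => u t (θ + s)) (fun s => pd2 (planeMap u) (t, θ + s)) _ _
      (by simpa using hu.mem t (hI ht) θ) (by simp) (hαN ht θ) (hα ht θ) e1
      (Eventually.of_forall fun s => hu.mem t (hI ht) _) (Eventually.of_forall (hβ ht θ)) e2
      (by simpa [lap] using hten ht θ)
    simpa [density, lap] using this
  · rintro ⟨t, θ⟩ ⟨ht, -⟩
    rw [real_inner_comm]
    refine hten ht θ _ ⟨fun s => u (t + s) θ, by simp, hαN ht θ, ?_⟩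
    simpa using (hα ht θ).self_of_nhds
  · rintro ⟨t, θ⟩ ⟨ht, -⟩
    rw [real_inner_comm]
    refine hten ht θ _ ⟨fun s => u t (θ + s), by simp,
      Eventually.of_forall fun s => hu.mem t (hI ht) _, ?_⟩
    simpa using hβ ht θ 0
  · intro t ht
    have h := hP t (hI ht)
    have c1 := continuous_slice h1.continuousOn ht
    have c2 := continuous_slice h2.continuousOn ht
    simp only [hu.dt_eq t ht, hu.dθ_eq t ht] at h
    rw [intervalIntegral.integral_sub (Continuous.intervalIntegrable (by fun_prop) _ _)
      (Continuous.intervalIntegrable (by fun_prop) _ _)] at h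
    linarith

/-- The differential inequality for the energy of slices. -/
theorem isSqrtSubsolution (hu : IsHarmonicMap N T u) (hT : 0 < T)
    (hU : IsHarmonicLike (Ioo 0 T) C (planeMap u)) {α β : ℝ} (hα : 0 ≤ α) (hβ : β ≤ T)
    {κ : ℝ → ℝ} (hκ : ∀ t ∈ Ioo α β, 0 < sliceEnergy T u t → ∃ s, 0 ≤ s ∧ C * s ≤ 2 ∧
      3 / 2 * (C * s) ≤ κ t ∧ ∀ θ, density (planeMap u) (t, θ) ≤ s ^ 2) :
    IsSqrtSubsolution α β κ (sliceEnergy T u) := by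
  obtain ⟨S₁, S₂, hS⟩ := hU.exists_deriv_energy
  refine ⟨(continuousOn_sliceEnergy hT hu.smooth).mono (Icc_subset_Icc hα hβ),
    fun t _ => sliceEnergy_nonneg T u t, S₁, S₂, fun t ht => ?_⟩
  have ht' : t ∈ Ioo 0 T := Ioo_subset_Ioo hα hβ ht
  obtain ⟨h1, h2, h3⟩ := hS t ht'
  refine ⟨h1.congr_of_eventuallyEq ?_, h2, fun h0 => ?_⟩
  · filter_upwards [isOpen_Ioo.mem_nhds ht'] with s hs
    exact hu.sliceEnergy_eq hs
  · obtain ⟨s, hs0, hs2, hsκ, hs⟩ := hκ t ht h0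
    have h4 := h3 s hs0 hs2 hs
    rw [← hu.sliceEnergy_eq ht'] at h4
    refine le_trans ?_ h4
    gcongr

end IsHarmonicMap

/-- A bound for the energy density on a slice in terms of the energy of the slice and of a bound for
the second derivatives. -/
theorem IsHarmonicLike.density_le_of_hessian {p : ℕ} {A : Set ℝ} {C : ℝ} {U : ℝ × ℝ → E p}
    (hU : IsHarmonicLike A C U) {t : ℝ} (ht : t ∈ A) {c : ℝ} (hc : 0 < c)
    (hH : ∀ θ, ‖pd2 (pd1 U) (t, θ)‖ ^ 2 + ‖pd2 (pd2 U) (t, θ)‖ ^ 2 ≤ c ^ 2) {σ : ℝ} (hσ : 0 < σ)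
    (hS : ∫ θ in (0 : ℝ)..(2 * Real.pi), density U (t, θ) = σ ^ 2) (θ : ℝ) :
    density U (t, θ) ≤ σ ^ 2 / (2 * Real.pi) + c * σ * (1 + 2 * Real.pi) := by
  have hD := hU.isOpen_strip
  have hπ := Real.pi_pos
  have h1 := contDiffOn_pd1 hD hU.smooth
  have h2 := contDiffOn_pd2 hD hU.smooth
  have hz : ∀ θ, (t, θ) ∈ A ×ˢ (univ : Set ℝ) := fun θ => ⟨ht, mem_univ θ⟩
  have ce := continuous_slice hU.contDiffOn_density.continuousOn ht
  have c1 := continuous_slice h1.continuousOn ht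
  have c2 := continuous_slice h2.continuousOn ht
  have c21 := continuous_slice (contDiffOn_pd2 hD h1).continuousOn ht
  have c22 := continuous_slice (contDiffOn_pd2 hD h2).continuousOn ht
  have hper : Function.Periodic (fun θ => density U (t, θ)) (2 * Real.pi) :=
    fun θ => hU.density_periodic ht θ
  obtain ⟨θ₁, -, hθ₁⟩ := exists_eq_const_mul_intervalIntegral_of_nonneg (a := 0)
    (b := 2 * Real.pi) (μ := volume) (f := fun θ => density U (t, θ)) (g := fun _ => (1 : ℝ))
    ce.continuousOn intervalIntegrable_const (fun _ _ => zero_le_one)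
  simp only [mul_one, hS, intervalIntegral.integral_const, sub_zero, smul_eq_mul] at hθ₁
  -- The density is compared with its value at `θ₁`, where it equals its mean, by integrating
  -- forward over at most one period.
  obtain ⟨θ₀, hθ₀, he⟩ := hper.exists_mem_Ico Real.two_pi_pos θ θ₁
  have he' : density U (t, θ) = density U (t, θ₀) := he
  have hderiv : ∀ θ, HasDerivAt (fun θ => density U (t, θ))
      (2 * inner ℝ (pd1 U (t, θ)) (pd2 (pd1 U) (t, θ)) +
        2 * inner ℝ (pd2 U (t, θ)) (pd2 (pd2 U) (t, θ))) θ := fun θ =>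
    (hasDerivAt_pd2 hD h1 (hz θ)).norm_sq.add (hasDerivAt_pd2 hD h2 (hz θ)).norm_sq
  -- The weight `c/σ` balances the energy `σ²` against the Hessian bound `c²`: both contributions
  -- become multiples of `cσ`.
  have hamgm : ∀ x y : E p, 2 * inner ℝ x y ≤ c / σ * ‖x‖ ^ 2 + σ / c * ‖y‖ ^ 2 := fun x y => by
    have h3 := real_inner_le_norm x y
    have h4 : 0 ≤ c / σ * (‖x‖ - σ / c * ‖y‖) ^ 2 := by positivity
    have h5 : c / σ * (‖x‖ - σ / c * ‖y‖) ^ 2 =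
        c / σ * ‖x‖ ^ 2 + σ / c * ‖y‖ ^ 2 - 2 * (‖x‖ * ‖y‖) := by
      field_simp; ring
    linarith
  have hbound : ∀ θ, 2 * inner ℝ (pd1 U (t, θ)) (pd2 (pd1 U) (t, θ)) +
      2 * inner ℝ (pd2 U (t, θ)) (pd2 (pd2 U) (t, θ)) ≤
      c / σ * density U (t, θ) + c * σ := fun θ => by
    have h3 := hamgm (pd1 U (t, θ)) (pd2 (pd1 U) (t, θ))
    have h4 := hamgm (pd2 U (t, θ)) (pd2 (pd2 U) (t, θ))
    have h5 := mul_le_mul_of_nonneg_left (hH θ) (by positivity : 0 ≤ σ / c)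
    have h6 : σ / c * c ^ 2 = c * σ := by field_simp
    rw [density]
    linarith
  have hb0 : ∀ θ, 0 ≤ c / σ * density U (t, θ) + c * σ := fun θ => by
    have := IsHarmonicLike.density_nonneg U (t, θ)
    positivity
  have hbint : ∀ a b, IntervalIntegrable (fun θ => c / σ * density U (t, θ) + c * σ) volume a b :=
    fun a b => Continuous.intervalIntegrable (by fun_prop) _ _
  have hdint : ∀ a b, IntervalIntegrable (fun θ =>
      2 * inner ℝ (pd1 U (t, θ)) (pd2 (pd1 U) (t, θ)) +
        2 * inner ℝ (pd2 U (t, θ)) (pd2 (pd2 U) (t, θ))) volume a b :=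
    fun a b => Continuous.intervalIntegrable (by fun_prop) _ _
  have hdiff : density U (t, θ₀) - density U (t, θ₁) ≤ c * σ * (1 + 2 * Real.pi) :=
    calc density U (t, θ₀) - density U (t, θ₁)
        = ∫ θ in θ₁..θ₀, (2 * inner ℝ (pd1 U (t, θ)) (pd2 (pd1 U) (t, θ)) +
            2 * inner ℝ (pd2 U (t, θ)) (pd2 (pd2 U) (t, θ))) :=
          (intervalIntegral.integral_eq_sub_of_hasDerivAt (fun θ _ => hderiv θ) (hdint _ _)).symm
      _ ≤ ∫ θ in θ₁..θ₀, (c / σ * density U (t, θ) + c * σ) :=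
          intervalIntegral.integral_mono hθ₀.1 (hdint _ _) (hbint _ _) hbound
      _ ≤ ∫ θ in θ₁..(θ₁ + 2 * Real.pi), (c / σ * density U (t, θ) + c * σ) :=
          intervalIntegral.integral_mono_interval le_rfl hθ₀.1 hθ₀.2.le
            (ae_of_all _ hb0) (hbint _ _)
      _ = c / σ * σ ^ 2 + c * σ * (2 * Real.pi) := by
          rw [intervalIntegral.integral_add (Continuous.intervalIntegrable (by fun_prop) _ _)
            intervalIntegrable_const, intervalIntegral.integral_const_mul,
            hper.intervalIntegral_add_eq θ₁ 0, zero_add, hS]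
          simp
          ring
      _ = _ := by field_simp
  have h3 : σ ^ 2 / (2 * Real.pi) = density U (t, θ₁) := by
    rw [hθ₁]; field_simp
  rw [he', h3]
  linarith

/-! ### The exponentially small potential for harmonic maps -/

section Sharp

variable {p : ℕ} {N : Set (E p)} {T C c : ℝ} {u : ℝ → ℝ → E p}

theorem integral_density_le {U : ℝ × ℝ → E p} {t M : ℝ} (h : ∀ θ, density U (t, θ) ≤ M)
    (hc : Continuous fun θ => density U (t, θ)) :
    ∫ θ in (0 : ℝ)..(2 * Real.pi), density U (t, θ) ≤ 2 * Real.pi * M := by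
  have h1 := intervalIntegral.integral_mono (μ := volume) Real.two_pi_pos.le
    (hc.intervalIntegrable _ _) intervalIntegrable_const h
  simpa using h1

theorem exp_add_exp_le_sq {x y : ℝ} :
    Real.exp (-x / 2) + Real.exp (-y / 2) ≤ (Real.exp (-x / 4) + Real.exp (-y / 4)) ^ 2 := by
  have h1 : ∀ x : ℝ, Real.exp (-x / 2) = Real.exp (-x / 4) ^ 2 := fun x => by
    rw [← Real.exp_nat_mul]; congr 1; push_cast; ring
  rw [h1, h1]
  nlinarith [mul_pos (Real.exp_pos (-x / 4)) (Real.exp_pos (-y / 4))]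

/-- The bootstrap with a Hessian bound. The crude pass gives slice norm `O(cX²)`, with `X` the sum
of the two exponentials of rate `1/4`; the density is `O(c)` times the slice norm, so `|∇u| =
O(cX)`. -/
theorem SharpAssumptions.isSqrtSubsolution {C₂ a b : ℝ} (hC : 1 ≤ C) (hN : HasCurvatureBound N N C)
    (hc : 0 < c) (hCc : C * c ≤ 1 / 1000) (h : SharpAssumptions N (c ^ 2) C₂ T a b u) :
    IsSqrtSubsolution 0 T (fun t => smallPotential (T - 0) (t - 0)) (sliceEnergy T u) := by
  have hT : 0 < T := zero_lt_one.trans_le h.one_le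
  have hu := h.harmonic
  have hU := hu.isHarmonicLike (zero_le_one.trans hC) hN h.pohozaev
  have hπ := Real.pi_pos
  have hπ3 := Real.pi_gt_three
  have hπ4 := Real.pi_lt_d2
  have hsmall := h.small
  rw [Real.sqrt_sq hc.le] at hsmall
  have hgrad : ∀ t ∈ Icc 0 T, ∀ θ, gradSq T u t θ ≤ c ^ 2 := fun t ht θ => by
    have h1 := hsmall t ht θ
    exact (Real.sqrt_le_left hc.le).1 (by linarith [Real.sqrt_nonneg (hessSq T u t θ)])
  have hhess : ∀ t ∈ Icc 0 T, ∀ θ, hessSq T u t θ ≤ c ^ 2 := fun t ht θ => by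
    have h1 := hsmall t ht θ
    exact (Real.sqrt_le_left hc.le).1 (by linarith [Real.sqrt_nonneg (gradSq T u t θ)])
  have hslice : ∀ t ∈ Icc 0 T, √(sliceEnergy T u t) ≤ 3 * c := fun t ht => by
    rw [Real.sqrt_le_left (by positivity)]
    have h1 := intervalIntegral.integral_mono (μ := volume) Real.two_pi_pos.le
      ((continuous_slice (continuousOn_gradSq hT hu.smooth) ht).intervalIntegrable _ _)
      intervalIntegrable_const (hgrad t ht)
    simp only [intervalIntegral.integral_const, sub_zero, smul_eq_mul] at h1
    rw [sliceEnergy]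
    nlinarith [sq_nonneg c]
  have hcrude := (hu.isSqrtSubsolution hT hU le_rfl le_rfl (κ := fun _ => 3 / 4) fun t ht _ =>
    ⟨c, hc.le, by linarith, by linarith, fun θ => by
      rw [← hu.gradSq_eq ht]; exact hgrad t (Ioo_subset_Icc_self ht) θ⟩).le_exp
  refine hu.isSqrtSubsolution hT hU le_rfl le_rfl fun t ht h0 => ?_
  have htI := Ioo_subset_Icc_self ht
  have hD := hU.isOpen_strip
  have hs := hu.contDiffOn_planeMap
  have hH : ∀ θ, ‖pd2 (pd1 (planeMap u)) (t, θ)‖ ^ 2 + ‖pd2 (pd2 (planeMap u)) (t, θ)‖ ^ 2 ≤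
      c ^ 2 := fun θ => by
    have h1 := hhess t htI θ
    rw [hessSq, dt_eq_pd1 (contDiffOn_pd2 hD hs) hu.dθ_eq ht,
      dθ_eq_pd2 (contDiffOn_pd2 hD hs) hu.dθ_eq ht, pd1_pd2_eq hD hs ⟨ht, mem_univ θ⟩] at h1
    nlinarith [sq_nonneg ‖dt T (dt T u) t θ‖, sq_nonneg ‖pd2 (pd1 (planeMap u)) (t, θ)‖]
  obtain ⟨σ, hσ⟩ : ∃ σ, σ = √(sliceEnergy T u t) := ⟨_, rfl⟩
  have hσ0 : 0 < σ := by rw [hσ]; exact Real.sqrt_pos.2 h0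
  have hdens := hU.density_le_of_hessian ht hc hH hσ0
    (by rw [← hu.sliceEnergy_eq ht, hσ, Real.sq_sqrt h0.le])
  have hσc : σ ≤ 3 * c := by rw [hσ]; exact hslice t htI
  obtain ⟨X, hX⟩ : ∃ X, X = Real.exp (-(t - 0) / 4) + Real.exp (-(T - t) / 4) := ⟨_, rfl⟩
  have hX0 : 0 < X := by rw [hX]; positivity
  have hX2 : X ≤ 2 := by
    have h1 : Real.exp (-(t - 0) / 4) ≤ 1 := Real.exp_le_one_iff.2 (by linarith [ht.1])
    have h2 : Real.exp (-(T - t) / 4) ≤ 1 := Real.exp_le_one_iff.2 (by linarith [ht.2])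
    linarith
  have hσX : σ ≤ 3 * c * X ^ 2 := by
    have h1 := hcrude t htI
    have h2 := exp_add_exp_le_sq (x := t - 0) (y := T - t)
    rw [← hX] at h2
    rw [← hσ] at h1
    have h3 := hslice 0 ⟨le_rfl, hT.le⟩
    have h4 := hslice T ⟨hT.le, le_rfl⟩
    calc σ ≤ _ := h1
      _ ≤ 3 * c * Real.exp (-(t - 0) / 2) + 3 * c * Real.exp (-(T - t) / 2) := by gcongr
      _ = 3 * c * (Real.exp (-(t - 0) / 2) + Real.exp (-(T - t) / 2)) := by ring
      _ ≤ _ := by gcongr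
  have hCcX : C * c * X ≤ 1 / 1000 * X := by gcongr
  -- The density is at most `8cσ ≤ 24c²X²`, within `(5cX)²`, and `(3/2)·5·Cc ≤ 1/10`.
  refine ⟨5 * c * X, by positivity, by linarith, ?_, fun θ => (hdens θ).trans ?_⟩
  · rw [smallPotential, show T - 0 - (t - 0) = T - t by ring, ← hX]
    linarith
  · have h1 : σ ^ 2 / (2 * Real.pi) ≤ c * σ := by
      rw [div_le_iff₀ (by positivity)]
      nlinarith [mul_pos hc hσ0]
    have h2 : c * σ * (1 + 2 * Real.pi) ≤ c * σ * (8 - 1 / 2) := by gcongr; linarith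
    have h3 : c * σ ≤ c * (3 * c * X ^ 2) := by gcongr
    have h4 : σ ^ 2 / (2 * Real.pi) ≤ 1 / 2 * (c * σ) := by
      rw [div_le_iff₀ (by positivity)]
      nlinarith [mul_pos hc hσ0]
    nlinarith [sq_nonneg (c * X)]

/-- The bootstrap without a Hessian bound: ε-regularity is used once for the crude decay and again
with the decayed energy. It consumes a collar at each end, hence `2 ≤ α` and `β ≤ T - 2`. -/
theorem IsHarmonicMap.isSqrtSubsolution_of_small_energy (hC : 1 ≤ C) (hN : HasCurvatureBound N N C)
    (hc : 0 < c) (hCc : C * c ≤ 1 / 1000) (hT : 4 < T) (hu : IsHarmonicMap N T u)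
    (hP : PohozaevZero T u)
    (hE : ∀ t ∈ Icc 1 (T - 1), ∫ s in (t - 1 / 2)..(t + 1 / 2), sliceEnergy T u s ≤ 2 * c ^ 2)
    {α β : ℝ} (hα : 2 ≤ α) (hβ : β ≤ T - 2) :
    IsSqrtSubsolution α β (fun t => smallPotential (β - α) (t - α)) (sliceEnergy T u) := by
  have hT0 : 0 < T := by linarith
  have hC0 : 0 < C := by linarith
  have hU := hu.isHarmonicLike hC0.le hN hP
  have hπ := Real.pi_pos
  have hπ3 := Real.pi_gt_three
  have hπ4 := Real.pi_lt_d2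
  have hmem : ∀ t ∈ Icc 1 (T - 1), Icc (t - 1 / 2) (t + 1 / 2) ⊆ Ioo 0 T := fun t ht s hs =>
    ⟨by linarith [hs.1, ht.1], by linarith [hs.2, ht.2]⟩
  have hself : ∀ t ∈ Icc 1 (T - 1), t ∈ Ioo 0 T := fun t ht =>
    hmem t ht ⟨by linarith, by linarith⟩
  have hCc2 : C ^ 2 * c ^ 2 ≤ (1 / 1000) ^ 2 := by
    rw [← mul_pow]
    gcongr
  have hreg : ∀ t ∈ Icc 1 (T - 1), ∀ θ, density (planeMap u) (t, θ) ≤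
      11 * ∫ s in (t - 1 / 2)..(t + 1 / 2), sliceEnergy T u s := fun t ht θ => by
    have e : ∫ s in (t - 1 / 2)..(t + 1 / 2), sliceEnergy T u s = ∫ s in (t - 1 / 2)..(t + 1 / 2),
        ∫ φ in (0 : ℝ)..(2 * Real.pi), density (planeMap u) (s, φ) := by
      refine intervalIntegral.integral_congr fun s hs => ?_
      rw [uIcc_of_le (by linarith)] at hs
      exact hu.sliceEnergy_eq (hmem t ht hs)
    have h1 := hE t ht
    have h0 : 0 ≤ ∫ s in (t - 1 / 2)..(t + 1 / 2), sliceEnergy T u s :=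
      intervalIntegral.integral_nonneg (by linarith) fun s _ => sliceEnergy_nonneg T u s
    rw [e] at h1 h0 ⊢
    refine (hU.density_le hC0 (hmem t ht) ?_ θ).trans ?_
    · have := mul_le_mul_of_nonneg_left h1 (by positivity : 0 ≤ 16 * C ^ 2)
      linarith
    · gcongr
      rw [div_le_iff₀ hπ]
      linarith
  -- The density is at most `11·2c² ≤ (5c)²`, where 11 bounds `32/π`.
  have hcrude := (hu.isSqrtSubsolution hT0 hU (α := 1) (β := T - 1) zero_le_one (by linarith)
    (κ := fun _ => 3 / 4) fun t ht _ => ⟨5 * c, by linarith, by linarith, by linarith, fun θ => by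
      have ht' := Ioo_subset_Icc_self ht
      have := hreg t ht' θ
      have := hE t ht'
      nlinarith [sq_nonneg c]⟩).le_exp
  have hslice : ∀ t ∈ Icc 1 (T - 1), √(sliceEnergy T u t) ≤ 12 * c := fun t ht => by
    rw [Real.sqrt_le_left (by positivity), hu.sliceEnergy_eq (hself t ht)]
    refine (integral_density_le (M := 22 * c ^ 2) (fun θ => ?_)
      (continuous_slice hU.contDiffOn_density.continuousOn (hself t ht))).trans ?_
    · linarith [hreg t ht θ, hE t ht]
    · nlinarith [sq_nonneg c]
  have hexp : ∀ x : ℝ, Real.exp (-x / 2) ^ 2 = Real.exp (-x) := fun x => by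
    rw [← Real.exp_nat_mul]; congr 1; push_cast; ring
  have hdecay : ∀ s ∈ Icc 1 (T - 1), sliceEnergy T u s ≤
      288 * c ^ 2 * (Real.exp (-(s - 1)) + Real.exp (-(T - 1 - s))) := fun s hs => by
    have h1 := hcrude s hs
    have h2 := hslice 1 ⟨le_rfl, by linarith⟩
    have h3 := hslice (T - 1) ⟨by linarith, le_rfl⟩
    have h4 : √(sliceEnergy T u s) ≤
        12 * c * (Real.exp (-(s - 1) / 2) + Real.exp (-(T - 1 - s) / 2)) := by
      calc √(sliceEnergy T u s) ≤ _ := h1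
        _ ≤ 12 * c * Real.exp (-(s - 1) / 2) + 12 * c * Real.exp (-(T - 1 - s) / 2) := by gcongr
        _ = _ := by ring
    rw [Real.sqrt_le_left (by positivity)] at h4
    rw [← hexp, ← hexp]
    set x := Real.exp (-(s - 1) / 2)
    set y := Real.exp (-(T - 1 - s) / 2)
    nlinarith [mul_nonneg (sq_nonneg c) (sq_nonneg (x - y))]
  refine hu.isSqrtSubsolution hT0 hU (by linarith) (by linarith) fun t ht _ => ?_
  have ht1 : t ∈ Icc 1 (T - 1) := ⟨by linarith [ht.1], by linarith [ht.2]⟩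
  obtain ⟨X, hX⟩ : ∃ X, X = Real.exp (-(t - α) / 4) + Real.exp (-(β - t) / 4) := ⟨_, rfl⟩
  have hX0 : 0 < X := by rw [hX]; positivity
  have hX2 : X ≤ 2 := by
    have h1 : Real.exp (-(t - α) / 4) ≤ 1 := Real.exp_le_one_iff.2 (by linarith [ht.1])
    have h2 : Real.exp (-(β - t) / 4) ≤ 1 := Real.exp_le_one_iff.2 (by linarith [ht.2])
    linarith
  have hCcX : C * c * X ≤ 1 / 1000 * X := by gcongr
  have hint : ∫ s in (t - 1 / 2)..(t + 1 / 2), sliceEnergy T u s ≤ 288 * c ^ 2 * X ^ 2 := by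
    have h1 : ∀ s ∈ Icc (t - 1 / 2) (t + 1 / 2), sliceEnergy T u s ≤ 288 * c ^ 2 * X ^ 2 :=
      fun s hs => by
        refine (hdecay s ⟨by linarith [hs.1, ht.1], by linarith [hs.2, ht.2]⟩).trans ?_
        gcongr
        have h2 := exp_add_exp_le_sq (x := t - α) (y := β - t)
        rw [← hX] at h2
        refine le_trans (add_le_add (Real.exp_le_exp.2 ?_) (Real.exp_le_exp.2 ?_)) h2
        · linarith [hs.1, ht.1]
        · linarith [hs.2, ht.2]
    have h2 := intervalIntegral.integral_mono_on (μ := volume) (by linarith)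
      (((continuousOn_sliceEnergy hT0 hu.smooth).mono fun s hs => ?_).intervalIntegrable)
      intervalIntegrable_const h1
    · simp only [intervalIntegral.integral_const, smul_eq_mul] at h2
      linarith
    · rw [uIcc_of_le (by linarith)] at hs
      exact Ioo_subset_Icc_self (hmem t ht1 hs)
  -- Here `11·288 ≤ 57²`, and `(3/2)·57·Cc ≤ 1/10` since `Cc ≤ 1/1000`.
  refine ⟨57 * c * X, by positivity, by linarith, ?_, fun θ => (hreg t ht1 θ).trans ?_⟩
  · rw [smallPotential, show β - α - (t - α) = β - t by ring, ← hX]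
    linarith
  · nlinarith [sq_nonneg (c * X)]

/-! ### The boundary value problem -/

theorem sinh_interpolation_eq {T : ℝ} (hT : 0 < T) (a b t : ℝ) :
    2 * ((a * Real.sinh (T - t) + b * Real.sinh (t - 0)) / Real.sinh (T - 0)) =
      2 * E₁ T a b * Real.exp (-t) + 2 * E₂ T a b * Real.exp t := by
  have hx := Real.exp_pos T
  have hy := Real.exp_pos t
  have hx1 : 1 < Real.exp T := Real.one_lt_exp_iff.2 hT
  have h2T : Real.exp (2 * T) = Real.exp T ^ 2 := by
    rw [← Real.exp_nat_mul]; norm_num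
  have hne : Real.exp T ^ 2 - 1 ≠ 0 := by nlinarith
  rw [sub_zero, sub_zero, E₁, E₂, h2T, Real.sinh_eq, Real.sinh_eq, Real.sinh_eq,
    show -(T - t) = t - T by ring, Real.exp_sub, Real.exp_sub, Real.exp_neg, Real.exp_neg]
  set x := Real.exp T
  set y := Real.exp t
  have hne' : x - x⁻¹ ≠ 0 := by
    have : x⁻¹ < 1 := inv_lt_one_of_one_lt₀ hx1
    linarith
  have e : (x - x⁻¹) = (x ^ 2 - 1) / x := by field_simp
  rw [e]
  field_simp
  ring

/-- Uniqueness comes from the two first integrals `(g' + g)e^{-t}` and `(g - g')e^t`, which show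
that `g` is a combination of `e^{±t}`; the boundary values fix the coefficients. -/
theorem solvesBVP_iff {T : ℝ} (hT : 0 < T) (a b : ℝ) (g : ℝ → ℝ) :
    SolvesBVP T (2 * a) (2 * b) g ↔ ∀ t ∈ Icc 0 T,
      g t = 2 * E₁ T a b * Real.exp (-t) + 2 * E₂ T a b * Real.exp t := by
  have hs : Real.sinh T ≠ 0 := (Real.sinh_pos_iff.2 hT).ne'
  have h0 : 2 * E₁ T a b * Real.exp (-0) + 2 * E₂ T a b * Real.exp 0 = 2 * a := by
    rw [← sinh_interpolation_eq hT]
    simp only [sub_zero, Real.sinh_zero, mul_zero, add_zero]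
    field_simp
  have hTT : 2 * E₁ T a b * Real.exp (-T) + 2 * E₂ T a b * Real.exp T = 2 * b := by
    rw [← sinh_interpolation_eq hT]
    simp only [sub_zero, sub_self, Real.sinh_zero, mul_zero, zero_add]
    field_simp
  have he : ∀ t, HasDerivAt (fun t => Real.exp (-t)) (-Real.exp (-t)) t := fun t =>
    (hasDerivAt_neg t).exp.congr_deriv (by ring)
  have memL : (0 : ℝ) ∈ Icc 0 T := ⟨le_rfl, hT.le⟩
  have memR : T ∈ Icc 0 T := ⟨hT.le, le_rfl⟩
  constructor
  · rintro ⟨hg0, hgT, g', hg⟩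
    have hconst : ∀ f : ℝ → ℝ, (∀ t ∈ Icc 0 T, HasDerivWithinAt f 0 (Icc 0 T) t) →
        ∀ t ∈ Icc 0 T, f t = f 0 := fun f hf =>
      constant_of_derivWithin_zero (fun t ht => (hf t ht).differentiableWithinAt) fun t ht =>
        (hf t (Ico_subset_Icc_self ht)).derivWithin
          (uniqueDiffOn_Icc hT t (Ico_subset_Icc_self ht))
    have h1 := hconst (fun t => (g' t + g t) * Real.exp (-t)) fun t ht =>
      (((hg t ht).2.add (hg t ht).1).mul (he t).hasDerivWithinAt).congr_deriv (by simp; ring)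
    have h2 := hconst (fun t => (g t - g' t) * Real.exp t) fun t ht =>
      (((hg t ht).1.sub (hg t ht).2).mul (Real.hasDerivAt_exp t).hasDerivWithinAt).congr_deriv
        (by simp; ring)
    simp only [neg_zero, Real.exp_zero, mul_one] at h1 h2
    have hee : ∀ t : ℝ, Real.exp (-t) * Real.exp t = 1 := fun t => by
      rw [← Real.exp_add]; simp
    have hform : ∀ t ∈ Icc 0 T, g t =
        (g 0 - g' 0) / 2 * Real.exp (-t) + (g' 0 + g 0) / 2 * Real.exp t := fun t ht => by
      rw [← h1 t ht, ← h2 t ht]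
      linear_combination (-g t) * hee t
    have hT1 := hform T memR
    rw [hgT] at hT1
    obtain ⟨A, hA⟩ : ∃ A, A = (g 0 - g' 0) / 2 := ⟨_, rfl⟩
    obtain ⟨B, hB⟩ : ∃ B, B = (g' 0 + g 0) / 2 := ⟨_, rfl⟩
    have hAB : A + B = 2 * a := by rw [hA, hB, ← hg0]; ring
    rw [neg_zero, Real.exp_zero, mul_one, mul_one] at h0
    rw [← hA, ← hB] at hT1
    have hBE : B = 2 * E₂ T a b := by
      have h3 : (B - 2 * E₂ T a b) * (Real.exp T - Real.exp (-T)) = 0 := by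
        have hA' : A = 2 * E₁ T a b + 2 * E₂ T a b - B := by linarith
        rw [hA'] at hT1
        linear_combination -hTT - hT1
      have h4 : Real.exp T - Real.exp (-T) ≠ 0 := by
        have := Real.exp_lt_exp.2 (by linarith : -T < T)
        linarith
      exact sub_eq_zero.1 ((mul_eq_zero.1 h3).resolve_right h4)
    have hAE : A = 2 * E₁ T a b := by linarith
    intro t ht
    rw [hform t ht, ← hA, ← hB, hAE, hBE]
  · intro h
    have hd : ∀ t, HasDerivAt
        (fun t => 2 * E₁ T a b * Real.exp (-t) + 2 * E₂ T a b * Real.exp t)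
        (2 * E₁ T a b * -Real.exp (-t) + 2 * E₂ T a b * Real.exp t) t := fun t =>
      ((he t).const_mul _).add ((Real.hasDerivAt_exp t).const_mul _)
    refine ⟨by rw [h 0 memL, h0], by rw [h T memR, hTT],
      fun t => 2 * E₁ T a b * -Real.exp (-t) + 2 * E₂ T a b * Real.exp t, fun t ht => ⟨?_, ?_⟩⟩
    · exact (hd t).hasDerivWithinAt.congr h (h t ht)
    · rw [h t ht]
      have := ((he t).fun_neg.const_mul (2 * E₁ T a b)).add
        ((Real.hasDerivAt_exp t).const_mul (2 * E₂ T a b))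
      rw [neg_neg] at this
      exact this.hasDerivWithinAt

/-! ### Growth over consecutive pieces -/

theorem exists_mul_eq_integral {S : ℝ → ℝ} {a b : ℝ} (hab : a ≤ b) (hS : ContinuousOn S (Icc a b)) :
    ∃ t ∈ Icc a b, ∫ s in a..b, S s = (b - a) * S t := by
  obtain ⟨t, ht, h⟩ := exists_eq_const_mul_intervalIntegral_of_nonneg (a := a) (b := b)
    (μ := volume) (f := S) (g := fun _ => (1 : ℝ)) (by rwa [uIcc_of_le hab])
    intervalIntegrable_const (fun _ _ => zero_le_one)
  rw [uIcc_of_le hab] at ht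
  refine ⟨t, ht, ?_⟩
  simpa [mul_comm] using h

/-- Slices realising the mean energies of `W₂`, `W₄` and `W_{m-1}` are used: the outer two stay away
from the ends, and growth from `W₂` to `W₄` supplies the comparison of slices, more than 2 apart
because `L > 2`. -/
theorem IsHarmonicMap.cylEnergy_growth (hC : 1 ≤ C) (hN : HasCurvatureBound N N C)
    (hc : 0 < c) (hCc : C * c ≤ 1 / 1000) {L : ℝ} {m : ℕ} (hL : 2 < L) (hm : 1 ≤ m)
    (hu : IsHarmonicMap N (m * L) u)
    (hE : ∀ i : ℕ, 1 ≤ i → i ≤ m → cylEnergy (m * L) u (((i : ℝ) - 1) * L) (i * L) < c ^ 2)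
    (hP : PohozaevZero (m * L) u)
    (hgrow : ∀ i : ℕ, 1 ≤ i → i + 1 ≤ m → cylEnergy (m * L) u (((i : ℝ) - 1) * L) (i * L) ≤
      1 / 2 * cylEnergy (m * L) u (i * L) (((i : ℝ) + 1) * L)) :
    cylEnergy (m * L) u 0 L ≤ 64 * Real.exp (14 * L) * Real.exp (-2 * (m * L)) *
      cylEnergy (m * L) u (((m : ℝ) - 1) * L) (m * L) := by
  have hL0 : 0 < L := by linarith
  have hm1 : (1 : ℝ) ≤ m := by exact_mod_cast hm
  obtain ⟨T, hT⟩ : ∃ T, T = m * L := ⟨_, rfl⟩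
  rw [← hT] at hu hP ⊢
  simp only [← hT] at hE hgrow
  have hT0 : 0 < T := by rw [hT]; positivity
  have hScont := continuousOn_sliceEnergy hT0 hu.smooth
  have hSint : ∀ a b, 0 ≤ a → a ≤ b → b ≤ T → IntervalIntegrable (sliceEnergy T u) volume a b :=
    fun a b h1 h2 h3 => ContinuousOn.intervalIntegrable <| by
      rw [uIcc_of_le h2]; exact hScont.mono (Icc_subset_Icc h1 h3)
  obtain ⟨e, he⟩ : ∃ e : ℕ → ℝ, ∀ i, e i = cylEnergy T u (((i : ℝ) - 1) * L) (i * L) :=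
    ⟨_, fun _ => rfl⟩
  have he0 : ∀ i, 0 ≤ e i := fun i => by
    rw [he]
    exact intervalIntegral.integral_nonneg (by nlinarith) fun s _ => sliceEnergy_nonneg T u s
  have hstep : ∀ i, 1 ≤ i → i + 1 ≤ m → e i ≤ 1 / 2 * e (i + 1) := fun i h1 h2 => by
    have := hgrow i h1 h2
    rw [he, he]
    push_cast
    rwa [add_sub_cancel_right]
  have he1 : cylEnergy T u 0 L = e 1 := by rw [he]; norm_num
  have hem : cylEnergy T u (((m : ℝ) - 1) * L) T = e m := by rw [he, ← hT]
  rw [he1, hem]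
  -- For few pieces the constant `64 e^{14L - 2mL}` is at least 1, and monotonicity of the energies
  -- suffices.
  rcases le_or_gt m 5 with hm5 | hm6
  · have hmono : ∀ k, 1 ≤ k → k ≤ m → e 1 ≤ e k := fun k hk => by
      induction k, hk using Nat.le_induction with
      | base => exact fun _ => le_rfl
      | succ k hk ih =>
        intro hkm
        linarith [ih (by omega), hstep k hk hkm, he0 (k + 1)]
    have h1 : 1 ≤ 64 * Real.exp (14 * L) * Real.exp (-2 * T) := by
      rw [mul_assoc, ← Real.exp_add]
      have h2 : (m : ℝ) ≤ 5 := by exact_mod_cast hm5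
      have h3 : 1 ≤ Real.exp (14 * L + -2 * T) := Real.one_le_exp (by rw [hT]; nlinarith)
      linarith
    exact (hmono m hm le_rfl).trans (le_mul_of_one_le_left (he0 m) h1)
  obtain ⟨k, rfl⟩ : ∃ k, m = k + 1 := ⟨m - 1, by omega⟩
  have hk5 : (5 : ℝ) ≤ k := by exact_mod_cast (by omega : 5 ≤ k)
  push_cast at hT
  have hTL : 6 * L ≤ T := by rw [hT]; nlinarith
  -- A window of length 1 is shorter than `L`, so it meets at most two consecutive pieces, each of
  -- energy below `c²`.
  have hsmall : ∀ t ∈ Icc 1 (T - 1),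
      ∫ s in (t - 1 / 2)..(t + 1 / 2), sliceEnergy T u s ≤ 2 * c ^ 2 := fun t ht => by
    have hpos : 0 ≤ (t - 1 / 2) / L := div_nonneg (by linarith [ht.1]) hL0.le
    obtain ⟨j, hj⟩ : ∃ j, j = ⌊(t - 1 / 2) / L⌋₊ := ⟨_, rfl⟩
    have hj1 : (j : ℝ) * L ≤ t - 1 / 2 := by
      rw [← le_div_iff₀ hL0, hj]; exact Nat.floor_le hpos
    have hj2 : t - 1 / 2 < ((j : ℝ) + 1) * L := by
      rw [← div_lt_iff₀ hL0, hj]; exact Nat.lt_floor_add_one _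
    have hjm : j + 1 ≤ k + 1 := by
      have : (j : ℝ) < (k + 1 : ℕ) := by
        push_cast
        refine lt_of_mul_lt_mul_right ?_ hL0.le
        linarith [ht.2]
      exact_mod_cast this
    have hjL : 0 ≤ (j : ℝ) * L := by positivity
    have hmono : ∀ b, t + 1 / 2 ≤ b → b ≤ T →
        ∫ s in (t - 1 / 2)..(t + 1 / 2), sliceEnergy T u s ≤
        ∫ s in ((j : ℝ) * L)..b, sliceEnergy T u s := fun b hb hbT =>
      intervalIntegral.integral_mono_interval hj1 (by linarith) hb
        (ae_of_all _ fun s => sliceEnergy_nonneg T u s) (hSint _ _ hjL (by linarith) hbT)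
    have hE1 := hE (j + 1) (by omega) hjm
    push_cast at hE1
    rw [add_sub_cancel_right, cylEnergy] at hE1
    rcases hjm.eq_or_lt with hjk | hjk
    · have hjk' : (j : ℝ) = k := by exact_mod_cast (by omega : j = k)
      have := hmono (((j : ℝ) + 1) * L) (by rw [hjk', ← hT]; linarith [ht.2])
        (by rw [hjk', ← hT])
      linarith [sq_nonneg c]
    · have hE2 := hE (j + 2) (by omega) (by omega)
      push_cast at hE2
      rw [show (j : ℝ) + 2 - 1 = j + 1 by ring, cylEnergy] at hE2
      have hjk' : (j : ℝ) + 2 ≤ k + 1 := by exact_mod_cast (by omega : j + 2 ≤ k + 1)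
      have hb : ((j : ℝ) + 2) * L ≤ T := by rw [hT]; gcongr
      have h1 := hmono (((j : ℝ) + 2) * L) (by linarith) hb
      rw [← intervalIntegral.integral_add_adjacent_intervals
        (hSint _ (((j : ℝ) + 1) * L) hjL (by linarith) (by linarith))
        (hSint _ _ (by linarith) (by linarith) hb)] at h1
      linarith
  have hmean : ∀ i : ℕ, 1 ≤ i → i ≤ k + 1 →
      ∃ t ∈ Icc (((i : ℝ) - 1) * L) (i * L), e i = L * sliceEnergy T u t := fun i hi1 hi2 => by
    have h1 : (1 : ℝ) ≤ i := by exact_mod_cast hi1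
    have h2 : (i : ℝ) ≤ k + 1 := by exact_mod_cast hi2
    obtain ⟨t, ht, h⟩ := exists_mul_eq_integral (S := sliceEnergy T u) (a := ((i : ℝ) - 1) * L)
      (b := i * L) (by nlinarith) (hScont.mono (Icc_subset_Icc (by nlinarith) (by rw [hT]; gcongr)))
    refine ⟨t, ht, ?_⟩
    rw [he, cylEnergy, h]
    ring
  obtain ⟨t₀, ht₀, ht₀e⟩ := hmean 2 (by omega) (by omega)
  obtain ⟨t₁, ht₁, ht₁e⟩ := hmean 4 (by omega) (by omega)
  obtain ⟨t₂, ht₂, ht₂e⟩ := hmean k (by omega) (by omega)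
  norm_num at ht₀ ht₁
  have ht₂l : T - 2 * L ≤ t₂ := by rw [hT]; linarith [ht₂.1]
  have ht₂u : t₂ ≤ T - L := by rw [hT]; linarith [ht₂.2]
  have h12 := hstep 1 le_rfl (by omega)
  have h23 := hstep 2 (by omega) (by omega)
  have h34 := hstep 3 (by omega) (by omega)
  have hkk := hstep k (by omega) le_rfl
  norm_num at h12 h23 h34
  have hle : sliceEnergy T u t₀ ≤ sliceEnergy T u t₁ := by
    refine le_of_mul_le_mul_left ?_ hL0
    rw [← ht₀e, ← ht₁e]
    linarith [he0 4]
  have hsub := hu.isSqrtSubsolution_of_small_energy hC hN hc hCc (by linarith) hP hsmall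
    (α := t₀) (β := t₂) (by linarith [ht₀.1]) (by linarith)
  have hkey := hsub.le_exp_mul_of_le (t := t₁) (by linarith [ht₀.2, ht₁.1])
    (by linarith [ht₁.2]) hle
  -- The dependence on `t₀` cancels; `t₁ ≤ 4L` and `t₂ ≥ T - 2L` give exponent at most `12L - 2T`,
  -- so `14L` leaves room.
  have hexp : 64 * Real.exp (2 * (t₁ - t₀)) * Real.exp (-2 * (t₂ - t₀)) ≤
      64 * Real.exp (14 * L) * Real.exp (-2 * T) := by
    rw [mul_assoc, mul_assoc, ← Real.exp_add, ← Real.exp_add]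
    exact mul_le_mul_of_nonneg_left (Real.exp_le_exp.2 (by linarith [ht₁.2])) (by norm_num)
  have hfin : sliceEnergy T u t₀ ≤
      64 * Real.exp (14 * L) * Real.exp (-2 * T) * sliceEnergy T u t₂ :=
    hkey.trans (mul_le_mul_of_nonneg_right hexp (sliceEnergy_nonneg T u t₂))
  have hK0 : 0 ≤ 64 * Real.exp (14 * L) * Real.exp (-2 * T) := by positivity
  calc e 1 ≤ e 2 := by linarith [he0 2]
    _ = L * sliceEnergy T u t₀ := ht₀e
    _ ≤ L * (64 * Real.exp (14 * L) * Real.exp (-2 * T) * sliceEnergy T u t₂) := by gcongr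
    _ = 64 * Real.exp (14 * L) * Real.exp (-2 * T) * e k := by rw [ht₂e]; ring
    _ ≤ 64 * Real.exp (14 * L) * Real.exp (-2 * T) * e (k + 1) := by
      gcongr
      linarith [he0 (k + 1)]

end Sharp

end CylHarmonic

theorem mainTheorem5 :
    ∃ C₃ C : ℝ → ℝ, ∀ (n p : ℕ) (N : Set (CylHarmonic.E p)),
      CylHarmonic.IsClosedSubmanifold n N → ∃ ε₁ : ℝ, 0 < ε₁ ∧
        -- the sharp pointwise-in-`t` bound, and its right-hand side as the solution of `g'' = g`
        (∀ (C₂ T a b : ℝ) (u : ℝ → ℝ → CylHarmonic.E p),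
          CylHarmonic.SharpAssumptions N ε₁ C₂ T a b u →
            (∀ t ∈ Set.Icc 0 T, √(CylHarmonic.sliceEnergy T u t) ≤
              2 * CylHarmonic.E₁ T a b * Real.exp (-t) + 2 * CylHarmonic.E₂ T a b * Real.exp t) ∧
            (∀ g : ℝ → ℝ, CylHarmonic.SolvesBVP T (2 * a) (2 * b) g ↔
              ∀ t ∈ Set.Icc 0 T, g t =
                2 * CylHarmonic.E₁ T a b * Real.exp (-t) +
                  2 * CylHarmonic.E₂ T a b * Real.exp t)) ∧
        -- sharp growth between the two end slices
        (∀ (C₂ L T a b : ℝ) (u : ℝ → ℝ → CylHarmonic.E p),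
          CylHarmonic.SharpAssumptions N ε₁ C₂ T a b u → 2 ≤ L → 4 * L < T →
            (∃ L' ∈ Set.Icc L (3 * L),
              CylHarmonic.sliceEnergy T u 0 ≤ CylHarmonic.sliceEnergy T u L') →
            CylHarmonic.sliceEnergy T u 0 ≤
              C₃ L * Real.exp (-2 * T) * CylHarmonic.sliceEnergy T u T) ∧
        -- mild growth on consecutive pieces `W_i = [(i-1)L, iL] × S¹` forces the sharp rate
        (∀ (L : ℝ) (m : ℕ) (u : ℝ → ℝ → CylHarmonic.E p), 2 < L → 1 ≤ m →
          CylHarmonic.IsHarmonicMap N (m * L) u →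
          (∀ i : ℕ, 1 ≤ i → i ≤ m →
            CylHarmonic.cylEnergy (m * L) u (((i : ℝ) - 1) * L) (i * L) < ε₁) →
          CylHarmonic.PohozaevZero (m * L) u →
          (∀ i : ℕ, 1 ≤ i → i + 1 ≤ m →
            CylHarmonic.cylEnergy (m * L) u (((i : ℝ) - 1) * L) (i * L) ≤
              1 / 2 * CylHarmonic.cylEnergy (m * L) u (i * L) (((i : ℝ) + 1) * L)) →
          CylHarmonic.cylEnergy (m * L) u 0 L ≤
            C L * Real.exp (-2 * (m * L)) *
              CylHarmonic.cylEnergy (m * L) u (((m : ℝ) - 1) * L) (m * L)) := by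
  refine ⟨fun L => 64 * Real.exp (6 * L), fun L => 64 * Real.exp (14 * L), fun n p N hN => ?_⟩
  obtain ⟨C, hC, hcurv⟩ := hN.exists_curvatureBound
  have hC0 : 0 < C := zero_lt_one.trans_le hC
  -- `ε₁ = c²` depends on `N` only through the curvature constant, while the constants in (2) and
  -- (3) are functions of `L` alone.
  obtain ⟨c, hc, hCc⟩ : ∃ c : ℝ, 0 < c ∧ C * c ≤ 1 / 1000 :=
    ⟨1 / (1000 * C), by positivity, le_of_eq (by field_simp)⟩
  refine ⟨c ^ 2, by positivity, fun C₂ T a b u h => ⟨?_, ?_⟩, fun C₂ L T a b u h hL hLT => ?_,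
    fun L m u hL hm hu hE hP hgrow => hu.cylEnergy_growth hC hcurv hc hCc hL hm hE hP hgrow⟩
  · have hT : 0 < T := zero_lt_one.trans_le h.one_le
    intro t ht
    have key := (h.isSqrtSubsolution hC hcurv hc hCc).le_two_mul_sinh hT t ht
    rwa [h.left_norm, h.right_norm, CylHarmonic.sinh_interpolation_eq hT] at key
  · exact CylHarmonic.solvesBVP_iff (zero_lt_one.trans_le h.one_le) a b
  · rintro ⟨L', hL', hle⟩
    have key := (h.isSqrtSubsolution hC hcurv hc hCc).le_exp_mul_of_le (t := L')
      (by linarith [hL'.1]) (by linarith [hL'.2]) hle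
    rw [sub_zero, sub_zero] at key
    refine key.trans (mul_le_mul_of_nonneg_right ?_ (CylHarmonic.sliceEnergy_nonneg T u T))
    have hexp : Real.exp (2 * L') ≤ Real.exp (6 * L) := Real.exp_le_exp.2 (by linarith [hL'.2])
    beta_reduce
    gcongr
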